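/- **Theorem.** All graphs are finite, simple and connected, and $c(G)=|E(G)|-|V(G)|+1$ denotes the cyclomatic number. For a vertex $u$ and an edge $e=vw$ put $d(u,e)=\min\{d(u,v),d(u,w)\}$. The vertex (resp. edge) metric dimension $\dim(G)$ (resp. $\mathrm{edim}(G)$) is the smallest size of a set $S\subseteq V(G)$ such that for any two distinct vertices (resp. edges) $x,x'$ of $G$ there is $s\in S$ with $d(s,x)\neq d(s,x')$. A set $S\subseteq V(G)$ is a vertex cut if $G-S$ is disconnected or has at most one vertex, and a graph is $2$-connected if each of its vertex cuts has at least two vertices. A non-trivial block of $G$ is a maximal $2$-connected subgraph of $G$ with at least three vertices. 1. Let $G$ be a graph with minimum degree $\delta(G)\ge 2$ that is not a cycle, and let $G_1,\dots,G_q$ be all non-trivial blocks of $G$. If $\dim(G_i)\le 2c(G_i)-1$ for every $i$ such that $G_i$ is not a cycle, then $\dim(G)\le 2c(G)-1$. If $\mathrm{edim}(G_i)\le 2c(G_i)-1$ for every $i$ such that $G_i$ is not a cycle, then $\mathrm{edim}(G)\le 2c(G)-1$. 2. Consequently, if the inequality $\dim(G)\le 2c(G)-1$ (resp. $\mathrm{edim}(G)\le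 2c(G)-1$) holds for every $2$-connected graph $G$ with $\delta(G)\ge2$ that is not a cycle, then it holds for every graph $G$ with $\delta(G)\ge 2$ that is not a cycle. -/

import Mathlib

universe u

namespace MetricDimension

variable {V : Type u}

/-- The distance `d(u, e) = min {d(u, v), d(u, w)}` from a vertex `u` to an edge `e = vw`. -/
noncomputable def edgeDist (G : SimpleGraph V) (u : V) (e : Sym2 V) : ℕ :=
  Sym2.lift ⟨fun v w => min (G.dist u v) (G.dist u w), fun _ _ => min_comm _ _⟩ e

/-- `S` distinguishes every pair of distinct vertices of `G`. -/
def IsVertexMetricGenerator (G : SimpleGraph V) (S : Finset V) : Prop :=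
  ∀ x y : V, x ≠ y → ∃ s ∈ S, G.dist s x ≠ G.dist s y

/-- `S` distinguishes every pair of distinct edges of `G`. -/
def IsEdgeMetricGenerator (G : SimpleGraph V) (S : Finset V) : Prop :=
  ∀ e ∈ G.edgeSet, ∀ f ∈ G.edgeSet, e ≠ f → ∃ s ∈ S, edgeDist G s e ≠ edgeDist G s f

/-- The vertex metric dimension of `G`: the least size of a vertex metric generator. -/
noncomputable def vdim (G : SimpleGraph V) : ℕ :=
  sInf {n | ∃ S : Finset V, S.card = n ∧ IsVertexMetricGenerator G S}

/-- The edge metric dimension of `G`: the least size of an edge metric generator. -/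
noncomputable def edim (G : SimpleGraph V) : ℕ :=
  sInf {n | ∃ S : Finset V, S.card = n ∧ IsEdgeMetricGenerator G S}

/-- The cyclomatic number `|E(G)| - |V(G)| + 1` of a finite connected graph. -/
noncomputable def cyclomatic (G : SimpleGraph V) : ℤ :=
  (G.edgeSet.ncard : ℤ) - (Nat.card V : ℤ) + 1

/-- `S` is a vertex cut: `G - S` is disconnected or trivial (at most one vertex). -/
def IsVertexCut (G : SimpleGraph V) (S : Set V) : Prop :=
  ¬ (G.induce Sᶜ).Preconnected ∨ Sᶜ.Subsingleton

/-- The vertex connectivity of a finite graph: the least size of a vertex cut. -/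
noncomputable def vertexConnectivity (G : SimpleGraph V) : ℕ :=
  sInf {n | ∃ S : Finset V, S.card = n ∧ IsVertexCut G (S : Set V)}

/-- `G` is `k`-connected: its vertex connectivity is at least `k`. -/
def IsKConnected (k : ℕ) (G : SimpleGraph V) : Prop :=
  k ≤ vertexConnectivity G

/-- A non-trivial block of `G`: a maximal 2-connected subgraph, with at least three vertices. -/
def IsNontrivialBlock {G : SimpleGraph V} (H : G.Subgraph) : Prop :=
  Maximal (fun K : G.Subgraph => IsKConnected 2 K.coe) H ∧ 3 ≤ H.verts.ncard

/-- `G` is a cycle `C_n` for some `n ≥ 3`. -/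
def IsCycleGraph (G : SimpleGraph V) : Prop :=
  ∃ n : ℕ, 3 ≤ n ∧ Nonempty (G ≃g SimpleGraph.cycleGraph n)

end MetricDimension

/-! The graph is cut at cut vertices, and sets of landmarks are glued back together. Across a cut
vertex `v` distances add, so a landmark on one side sees the other side exactly as `v` does, up to a
constant. Hence any landmark on one side stands in for `v` on the other. What gluing must still
settle is a pair with one element on each side; for this it suffices that, on one of the sides, no
element except `v` is seen by all landmarks of that side through `v`. This is `Protects`, and
`Protects.distinguishes_across` gives the separation.

Every 2-connected piece with root `w` has `2c` landmarks that protect and, together with `w`,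
distinguish (`BlockBound.exists_protecting`). In a cycle these are the two neighbours of `w`. In
another block, `2c - 1` landmarks distinguish by assumption, and at most one neighbour of `w` can
spoil protection, so it is added. Bridges have cyclomatic number 0 and need no landmarks of their
own, because minimum degree two forces something to hang off their far ends. As `c` is additive over
splits, induction gives `2c` landmarks for every rooted piece
(`BlockBound.exists_protecting_of_degree`).

One landmark has to be saved. If there is a cut vertex, some end block is 2-connected; it need not
protect, since the rest of the graph does, so `2c - 1` landmarks suffice there
(`BlockBound.exists_rooted`, `Distinguishes.glue_root`).

Vertices and edges are handled together: a vertex `x` is the degenerate pair `s(x, x)`. -/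

namespace MetricDimension
variable {V : Type u}

/-! ### Distances to vertices and to pairs -/

section Distances

variable {G : SimpleGraph V}

theorem le_add_dist_of_adj (hG : G.Connected) (f : V → ℕ)
    (hf : ∀ a b, G.Adj a b → f b ≤ f a + 1) (x y : V) : f y ≤ f x + G.dist x y := by
  obtain ⟨p, hp⟩ := hG.exists_walk_length_eq_dist x y
  rw [← hp]
  clear hp
  induction p with
  | nil => simp
  | cons h p ih =>
    have := hf _ _ h
    rw [SimpleGraph.Walk.length_cons]
    omega

theorem dist_adj_le (hG : G.Connected) {x a b : V} (h : G.Adj a b) :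
    G.dist x b ≤ G.dist x a + 1 := by
  have h1 := hG.dist_triangle (u := x) (v := a) (w := b)
  rw [SimpleGraph.dist_eq_one_iff_adj.2 h] at h1
  exact h1

theorem exists_adj_dist_eq (hG : G.Connected) {x y : V} (h : x ≠ y) :
    ∃ u, G.Adj x u ∧ G.dist x y = G.dist u y + 1 := by
  obtain ⟨p, hp⟩ := hG.exists_walk_length_eq_dist x y
  cases p with
  | nil => exact absurd rfl h
  | @cons _ u _ hu p =>
    refine ⟨u, hu, ?_⟩
    have h1 := SimpleGraph.dist_le p
    have h2 := dist_adj_le hG (x := y) hu.symm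
    rw [SimpleGraph.Walk.length_cons] at hp
    rw [SimpleGraph.dist_comm (u := y), SimpleGraph.dist_comm (u := y)] at h2
    omega

/-- The set of vertices of an unordered pair lies in `W`. -/
def Within (W : Set V) (e : Sym2 V) : Prop := ∀ x ∈ e, x ∈ W

@[simp] theorem within_mk {W : Set V} {x y : V} : Within W s(x, y) ↔ x ∈ W ∧ y ∈ W := by
  simp [Within]

@[simp] theorem edgeDist_mk (s x y : V) :
    edgeDist G s s(x, y) = min (G.dist s x) (G.dist s y) := rfl

theorem edgeDist_le {e : Sym2 V} {x : V} (s : V) (hx : x ∈ e) : edgeDist G s e ≤ G.dist s x := by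
  induction e using Sym2.ind with
  | h a b =>
    rw [Sym2.mem_iff] at hx
    rcases hx with rfl | rfl <;> simp

theorem exists_edgeDist_eq (s : V) (e : Sym2 V) : ∃ x ∈ e, edgeDist G s e = G.dist s x := by
  induction e using Sym2.ind with
  | h a b =>
    rcases min_choice (G.dist s a) (G.dist s b) with h | h
    · exact ⟨a, by simp, by rw [edgeDist_mk, h]⟩
    · exact ⟨b, by simp, by rw [edgeDist_mk, h]⟩

theorem edgeDist_le_add (hG : G.Connected) (s v : V) (e : Sym2 V) :
    edgeDist G s e ≤ G.dist s v + edgeDist G v e := by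
  obtain ⟨x, hx, h⟩ := exists_edgeDist_eq (G := G) v e
  exact (edgeDist_le s hx).trans (h ▸ hG.dist_triangle)

end Distances

/-! ### Retracts and splits at a cut vertex -/

/-- `r` retracts `V` onto `W`, collapsing everything hanging off a vertex of `W` to it. -/
structure IsRetraction (G : SimpleGraph V) (W : Set V) (r : V → V) : Prop where
  mem : ∀ z, r z ∈ W
  fix : ∀ z ∈ W, r z = z
  adj : ∀ ⦃y z⦄, G.Adj y z → r y = r z ∨ (y ∈ W ∧ z ∈ W)

/-- `W` is glued from `W₁` and `W₂` along the single vertex `v`. -/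
structure IsSplit (G : SimpleGraph V) (W W₁ W₂ : Set V) (v : V) : Prop where
  union : W₁ ∪ W₂ = W
  inter : W₁ ∩ W₂ = {v}
  adj : ∀ x ∈ W₁, ∀ y ∈ W₂, G.Adj x y → x = v ∨ y = v
  left : ∃ x ∈ W₁, x ≠ v
  right : ∃ x ∈ W₂, x ≠ v

namespace IsSplit

variable {G : SimpleGraph V} {W W₁ W₂ : Set V} {v : V}

theorem symm (h : IsSplit G W W₁ W₂ v) : IsSplit G W W₂ W₁ v :=
  ⟨by rw [Set.union_comm, h.union], by rw [Set.inter_comm, h.inter],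
    fun x hx y hy a => (h.adj y hy x hx a.symm).symm, h.right, h.left⟩

theorem mem_left (h : IsSplit G W W₁ W₂ v) : v ∈ W₁ :=
  (h.inter.symm ▸ Set.mem_singleton v : v ∈ W₁ ∩ W₂).1

theorem mem_right (h : IsSplit G W W₁ W₂ v) : v ∈ W₂ := h.symm.mem_left

theorem left_subset (h : IsSplit G W W₁ W₂ v) : W₁ ⊆ W := h.union ▸ Set.subset_union_left

theorem right_subset (h : IsSplit G W W₁ W₂ v) : W₂ ⊆ W := h.symm.left_subset

theorem eq (h : IsSplit G W W₁ W₂ v) {x : V} (h₁ : x ∈ W₁) (h₂ : x ∈ W₂) : x = v := by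
  have : x ∈ W₁ ∩ W₂ := ⟨h₁, h₂⟩
  rw [h.inter] at this
  exact this

theorem or_mem (h : IsSplit G W W₁ W₂ v) {x : V} (hx : x ∈ W) : x ∈ W₁ ∨ x ∈ W₂ := by
  rw [← h.union] at hx
  exact hx

theorem adj_within (h : IsSplit G W W₁ W₂ v) {x y : V} (hx : x ∈ W) (hy : y ∈ W)
    (a : G.Adj x y) : (x ∈ W₁ ∧ y ∈ W₁) ∨ (x ∈ W₂ ∧ y ∈ W₂) := by
  rcases h.or_mem hx with hx | hx <;> rcases h.or_mem hy with hy | hy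
  · exact .inl ⟨hx, hy⟩
  · rcases h.adj x hx y hy a with rfl | rfl
    · exact .inr ⟨h.mem_right, hy⟩
    · exact .inl ⟨hx, h.mem_left⟩
  · rcases h.adj y hy x hx a.symm with rfl | rfl
    · exact .inr ⟨hx, h.mem_right⟩
    · exact .inl ⟨h.mem_left, hy⟩
  · exact .inr ⟨hx, hy⟩

theorem ssubset_left (h : IsSplit G W W₁ W₂ v) : W₁ ⊂ W := by
  refine ⟨h.left_subset, fun h' => ?_⟩
  obtain ⟨x, hx, hne⟩ := h.right
  exact hne (h.eq (h' (h.right_subset hx)) hx)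

theorem ncard_add [Finite V] (h : IsSplit G W W₁ W₂ v) :
    W.ncard + 1 = W₁.ncard + W₂.ncard := by
  have := Set.ncard_union_add_ncard_inter W₁ W₂
  rw [h.union, h.inter, Set.ncard_singleton] at this
  exact this

-- The map is `r` followed by the collapse of `W₂` to `v`. It lets an induction pass from a retract
-- to the sides of a split.
open Classical in
theorem retraction {r : V → V} (h : IsSplit G W W₁ W₂ v) (hr : IsRetraction G W r) :
    IsRetraction G W₁ (fun z => if r z ∈ W₁ then r z else v) where
  mem z := by
    split_ifs with hz
    exacts [hz, h.mem_left]
  fix z hz := by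
    have := hr.fix z (h.left_subset hz)
    simp [this, hz]
  adj y z a := by
    rcases hr.adj a with e | ⟨hy, hz⟩
    · left
      simp [e]
    · rcases h.adj_within hy hz a with h1 | h2
      · exact .inr h1
      · left
        have key : ∀ x ∈ W₂, x ∈ W → (if r x ∈ W₁ then r x else v) = v := by
          intro x hx hx'
          rw [hr.fix x hx']
          split_ifs with h3
          exacts [h.eq h3 hx, rfl]
        simp only [key y h2.1 hy, key z h2.2 hz]

end IsSplit

namespace IsRetraction

variable {G : SimpleGraph V} {W W₁ W₂ : Set V} {r : V → V}

theorem univ (G : SimpleGraph V) : IsRetraction G Set.univ id :=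
  ⟨fun _ => trivial, fun _ _ => rfl, fun _ _ _ => .inr ⟨trivial, trivial⟩⟩

theorem eq_or_adj (hr : IsRetraction G W r) {y z : V} (a : G.Adj y z) :
    r y = r z ∨ (y ∈ W ∧ z ∈ W ∧ r y = y ∧ r z = z) := by
  rcases hr.adj a with h | ⟨hy, hz⟩
  · exact .inl h
  · exact .inr ⟨hy, hz, hr.fix y hy, hr.fix z hz⟩

theorem dist_le (hG : G.Connected) (hr : IsRetraction G W r) {x : V} (hx : x ∈ W) (y : V) :
    G.dist x (r y) ≤ G.dist x y := by
  have := le_add_dist_of_adj hG (fun z => G.dist x (r z)) (fun a b h => by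
    rcases hr.eq_or_adj h with e | ⟨-, -, ha, hb⟩
    · rw [e]; omega
    · rw [ha, hb]; exact dist_adj_le hG h) x y
  simpa [hr.fix x hx] using this

/-- A shortest path between two vertices of `W` can be started inside `W`. -/
theorem exists_adj_dist_eq (hG : G.Connected) (hr : IsRetraction G W r) {x y : V} (hx : x ∈ W)
    (hy : y ∈ W) (h : x ≠ y) : ∃ u ∈ W, G.Adj x u ∧ G.dist x y = G.dist u y + 1 := by
  obtain ⟨u, hu, hd⟩ := MetricDimension.exists_adj_dist_eq hG h
  refine ⟨u, ?_, hu, hd⟩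
  rcases hr.adj hu with e | ⟨-, hW⟩
  -- If the first step left `W`, then `u` would collapse back to `x`; as `r` does not increase
  -- distances to `y`, no progress would have been made.
  · have h1 := hr.dist_le hG hy u
    rw [← e, hr.fix x hx, SimpleGraph.dist_comm, SimpleGraph.dist_comm (u := y)] at h1
    omega
  · exact hW

theorem dist_eq_add {v : V} (hG : G.Connected) (hr : IsRetraction G W r)
    (h : IsSplit G W W₁ W₂ v) {x y : V} (hx : x ∈ W₁) (hy : y ∈ W₂) :
    G.dist x y = G.dist x v + G.dist v y := by
  classical
  refine le_antisymm hG.dist_triangle ?_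
  -- The length of a route from `x` forced through `v`. Composed with `r`, it grows by at most one
  -- along each edge, so it is a lower bound for the distance.
  let f : V → ℕ := fun z => if z ∈ W₁ then G.dist x z else G.dist x v + G.dist v z
  have f₂ : ∀ z ∈ W₂, f z = G.dist x v + G.dist v z := by
    intro z hz
    simp only [f]
    split_ifs with h1
    · rw [h.eq h1 hz]; simp
    · rfl
  have f₁ : ∀ z ∈ W₁, f z = G.dist x z := fun z hz => by simp only [f, if_pos hz]
  have := le_add_dist_of_adj hG (fun z => f (r z)) (fun a b hab => by
    rcases hr.eq_or_adj hab with e | ⟨ha, hb, ha', hb'⟩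
    · rw [e]; omega
    · rw [ha', hb']
      rcases h.adj_within ha hb hab with ⟨h1, h2⟩ | ⟨h1, h2⟩
      · rw [f₁ _ h1, f₁ _ h2]; exact dist_adj_le hG hab
      · rw [f₂ _ h1, f₂ _ h2]
        have := dist_adj_le hG (x := v) hab
        omega) x y
  rw [hr.fix x (h.left_subset hx), hr.fix y (h.right_subset hy), f₁ x hx, f₂ y hy] at this
  simpa using this

theorem edgeDist_eq_add {v : V} (hG : G.Connected) (hr : IsRetraction G W r)
    (h : IsSplit G W W₁ W₂ v) {x : V} {e : Sym2 V} (hx : x ∈ W₁) (he : Within W₂ e) :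
    edgeDist G x e = G.dist x v + edgeDist G v e := by
  induction e using Sym2.ind with
  | h a b =>
    rw [within_mk] at he
    rw [edgeDist_mk, edgeDist_mk, hr.dist_eq_add hG h hx he.1, hr.dist_eq_add hG h hx he.2,
      min_add_add_left]

theorem exists_walk (hr : IsRetraction G W r) {x y : V} (p : G.Walk x y) :
    ∃ q : (G.induce W).Walk ⟨r x, hr.mem x⟩ ⟨r y, hr.mem y⟩, q.length ≤ p.length := by
  induction p with
  | nil => exact ⟨.nil, le_rfl⟩
  | @cons a b c hab p ih =>
    obtain ⟨q, hq⟩ := ih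
    rcases hr.eq_or_adj hab with e | ⟨ha, hb, ha', hb'⟩
    · refine ⟨q.copy (by simp [e]) rfl, ?_⟩
      simp only [SimpleGraph.Walk.length_copy, SimpleGraph.Walk.length_cons]
      omega
    · refine ⟨.cons (by simpa [ha', hb'] using hab) q, ?_⟩
      simp only [SimpleGraph.Walk.length_cons]
      omega

theorem connected (hG : G.Connected) (hr : IsRetraction G W r) : (G.induce W).Connected := by
  rw [SimpleGraph.connected_iff_exists_forall_reachable]
  obtain ⟨z⟩ := hG.nonempty
  refine ⟨⟨r z, hr.mem z⟩, fun y => ?_⟩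
  obtain ⟨p⟩ := hG.preconnected z y
  obtain ⟨q, -⟩ := hr.exists_walk p
  exact ⟨q.copy rfl (by simp [hr.fix y y.2])⟩

theorem dist_induce (hG : G.Connected) (hr : IsRetraction G W r) (x y : W) :
    (G.induce W).dist x y = G.dist x y := by
  apply le_antisymm
  · obtain ⟨p, hp⟩ := hG.exists_walk_length_eq_dist x y
    obtain ⟨q, hq⟩ := hr.exists_walk p
    have := SimpleGraph.dist_le (q.copy (u' := x) (v' := y) (Subtype.ext (hr.fix x x.2))
      (Subtype.ext (hr.fix y y.2)))
    rw [SimpleGraph.Walk.length_copy] at this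
    omega
  · obtain ⟨p, hp⟩ := (hr.connected hG).exists_walk_length_eq_dist x y
    have := SimpleGraph.dist_le (p.map (SimpleGraph.Embedding.induce W).toHom)
    rw [SimpleGraph.Walk.length_map, hp] at this
    exact this

end IsRetraction

/-! ### Additivity of the cyclomatic number -/

/-- The cyclomatic number of the subgraph of `G` induced on `W`. -/
noncomputable def cyc (G : SimpleGraph V) (W : Set V) : ℤ :=
  ({e | e ∈ G.edgeSet ∧ Within W e}.ncard : ℤ) - W.ncard + 1

theorem IsSplit.cyc_add [Finite V] {G : SimpleGraph V} {W W₁ W₂ : Set V} {v : V}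
    (h : IsSplit G W W₁ W₂ v) : cyc G W = cyc G W₁ + cyc G W₂ := by
  have h1 := h.ncard_add
  have h2 : {e | e ∈ G.edgeSet ∧ Within W e} =
      {e | e ∈ G.edgeSet ∧ Within W₁ e} ∪ {e | e ∈ G.edgeSet ∧ Within W₂ e} := by
    ext e
    induction e using Sym2.ind with
    | h a b =>
      simp only [Set.mem_ofPred_eq, Set.mem_union, within_mk, SimpleGraph.mem_edgeSet]
      constructor
      · rintro ⟨hab, ha, hb⟩
        rcases h.adj_within ha hb hab with h3 | h3
        exacts [.inl ⟨hab, h3⟩, .inr ⟨hab, h3⟩]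
      · rintro (⟨hab, ha, hb⟩ | ⟨hab, ha, hb⟩)
        exacts [⟨hab, h.left_subset ha, h.left_subset hb⟩,
          ⟨hab, h.right_subset ha, h.right_subset hb⟩]
  have h3 : Disjoint {e | e ∈ G.edgeSet ∧ Within W₁ e} {e | e ∈ G.edgeSet ∧ Within W₂ e} := by
    rw [Set.disjoint_left]
    intro e
    induction e using Sym2.ind with
    | h a b =>
      simp only [Set.mem_ofPred_eq, within_mk, SimpleGraph.mem_edgeSet]
      rintro ⟨hab, ha, hb⟩ ⟨-, ha', hb'⟩
      exact hab.ne ((h.eq ha ha').trans (h.eq hb hb').symm)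
  have h4 := Set.ncard_union_eq h3 (Set.toFinite _) (Set.toFinite _)
  unfold cyc
  rw [h2, h4]
  push_cast
  omega

/-! ### Distinguishing and protecting sets, and their gluing -/

/-- `T` distinguishes the elements of `𝓔` within `W`. -/
def Distinguishes (G : SimpleGraph V) (𝓔 : Set (Sym2 V)) (W T : Set V) : Prop :=
  ∀ e ∈ 𝓔, ∀ f ∈ 𝓔, Within W e → Within W f → e ≠ f →
    ∃ s ∈ T, edgeDist G s e ≠ edgeDist G s f

/-- No element of `𝓔` within `W`, except `w` itself, is seen from all of `T` through `w`. -/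
def Protects (G : SimpleGraph V) (𝓔 : Set (Sym2 V)) (W : Set V) (w : V) (T : Set V) : Prop :=
  ∀ e ∈ 𝓔, Within W e → e ≠ s(w, w) →
    ∃ s ∈ T, edgeDist G s e < G.dist s w + edgeDist G w e

/-- `𝓔` consists of the vertices of `G`, seen as degenerate pairs, or of the edges of `G`. -/
def IsElementSet (G : SimpleGraph V) (𝓔 : Set (Sym2 V)) : Prop :=
  𝓔 = {e | e.IsDiag} ∨ 𝓔 = G.edgeSet

section

variable {G : SimpleGraph V} {𝓔 : Set (Sym2 V)} {W W₁ W₂ T T₁ T₂ : Set V} {r : V → V} {v w : V}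

theorem Distinguishes.mono {T' : Set V} (h : Distinguishes G 𝓔 W T) (hT : T ⊆ T') :
    Distinguishes G 𝓔 W T' := fun e he f hf h1 h2 h3 =>
  let ⟨s, hs, h4⟩ := h e he f hf h1 h2 h3
  ⟨s, hT hs, h4⟩

theorem Protects.mono {T' : Set V} (h : Protects G 𝓔 W w T) (hT : T ⊆ T') :
    Protects G 𝓔 W w T' := fun e he h1 h2 =>
  let ⟨s, hs, h4⟩ := h e he h1 h2
  ⟨s, hT hs, h4⟩

theorem IsElementSet.eq_or_adj (hE : IsElementSet G 𝓔) {x y : V} (h : s(x, y) ∈ 𝓔) :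
    x = y ∨ G.Adj x y := by
  rcases hE with rfl | rfl
  · exact .inl (by simpa using h)
  · exact .inr (by simpa using h)

theorem IsElementSet.within_or (hE : IsElementSet G 𝓔) (h : IsSplit G W W₁ W₂ v) {e : Sym2 V}
    (he : e ∈ 𝓔) (hW : Within W e) : Within W₁ e ∨ Within W₂ e := by
  induction e using Sym2.ind with
  | h a b =>
    simp only [within_mk] at hW ⊢
    rcases hE.eq_or_adj he with rfl | hab
    · simpa using h.or_mem hW.1
    · exact h.adj_within hW.1 hW.2 hab

theorem IsElementSet.exists_within (hE : IsElementSet G 𝓔) (hG : G.Connected)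
    (hr : IsRetraction G W r) (hv : v ∈ W) (h : ∃ x ∈ W, x ≠ v) :
    ∃ e ∈ 𝓔, Within W e ∧ e ≠ s(v, v) := by
  obtain ⟨x, hx, hxv⟩ := h
  obtain ⟨u, hu, hvu, -⟩ := hr.exists_adj_dist_eq hG hv hx hxv.symm
  rcases hE with rfl | rfl
  · exact ⟨s(u, u), by simp, by simpa using hu, by simpa using hvu.ne'⟩
  · exact ⟨s(v, u), by simpa using hvu, by simp [hu, hv], by simpa using hvu.ne'⟩

theorem Protects.nonempty (hp : Protects G 𝓔 W v T) (hE : IsElementSet G 𝓔) (hG : G.Connected)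
    (hr : IsRetraction G W r) (hv : v ∈ W) (h : ∃ x ∈ W, x ≠ v) : T.Nonempty := by
  obtain ⟨e, he, heW, hne⟩ := hE.exists_within hG hr hv h
  obtain ⟨s, hs, -⟩ := hp e he heW hne
  exact ⟨s, hs⟩

/-- The landmark `v` may be dropped: any `t ∈ T₂` sees both `w` and the elements of `W₁` through
`v`, so it inherits the strict inequality of `v`. -/
theorem Protects.glue (hG : G.Connected) (hE : IsElementSet G 𝓔) (hr : IsRetraction G W r)
    (h : IsSplit G W W₁ W₂ v) (hw : w ∈ W₁) (p₁ : Protects G 𝓔 W₁ w (insert v T₁))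
    (p₂ : Protects G 𝓔 W₂ v T₂) (hT₂ : T₂ ⊆ W₂) (hne : T₂.Nonempty) :
    Protects G 𝓔 W w (T₁ ∪ T₂) := by
  intro e he heW hew
  have left : Within W₁ e → ∃ s ∈ T₁ ∪ T₂, edgeDist G s e < G.dist s w + edgeDist G w e := by
    intro h1
    obtain ⟨s, hs, hlt⟩ := p₁ e he h1 hew
    rcases hs with rfl | hs
    · obtain ⟨t, ht⟩ := hne
      refine ⟨t, .inr ht, ?_⟩
      rw [hr.edgeDist_eq_add hG h.symm (hT₂ ht) h1, hr.dist_eq_add hG h.symm (hT₂ ht) hw]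
      omega
    · exact ⟨s, .inl hs, hlt⟩
  rcases hE.within_or h he heW with h1 | h2
  · exact left h1
  · by_cases hev : e = s(v, v)
    · exact left (by subst hev; simpa using h.mem_left)
    · obtain ⟨s, hs, hlt⟩ := p₂ e he h2 hev
      refine ⟨s, .inr hs, ?_⟩
      rw [hr.dist_eq_add hG h.symm (hT₂ hs) hw, hr.edgeDist_eq_add hG h hw h2]
      omega

theorem edgeDist_ne_of_split (hG : G.Connected) (hr : IsRetraction G W r)
    (h : IsSplit G W W₁ W₂ v) {s : V} (hs : s ∈ W₂) {e f : Sym2 V} (he : Within W₁ e)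
    (hf : Within W₁ f) (hne : edgeDist G v e ≠ edgeDist G v f) :
    edgeDist G s e ≠ edgeDist G s f := by
  rw [hr.edgeDist_eq_add hG h.symm hs he, hr.edgeDist_eq_add hG h.symm hs hf]
  omega

/-- Let `s` protect `f`. If `s` sees `e` and `f` equally far, then `e` is strictly closer to `v`
than `f` is, because `s` reaches `e` through `v` but has a shortcut to `f`. Then `w`, which reaches
`f` only through `v`, is strictly closer to `e`. -/
theorem Protects.distinguishes_across (hG : G.Connected) (hr : IsRetraction G W r)
    (h : IsSplit G W W₁ W₂ v) (p₂ : Protects G 𝓔 W₂ v T₂) (hT₂ : T₂ ⊆ W₂) {e f : Sym2 V}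
    (he : Within W₁ e) (hf : Within W₂ f) (hf' : f ∈ 𝓔) (hfv : f ≠ s(v, v)) (hw : w ∈ W₁) :
    ∃ s ∈ insert w T₂, edgeDist G s e ≠ edgeDist G s f := by
  obtain ⟨s, hs, hlt⟩ := p₂ f hf' hf hfv
  by_cases hne : edgeDist G s e = edgeDist G s f
  · refine ⟨w, .inl rfl, ?_⟩
    rw [hr.edgeDist_eq_add hG h.symm (hT₂ hs) he] at hne
    rw [hr.edgeDist_eq_add hG h hw hf]
    have := edgeDist_le_add hG w v e
    omega
  · exact ⟨s, .inr hs, hne⟩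

/-- A symmetric relation on elements holds if it holds within each side of a split and across. -/
theorem IsElementSet.split_cases (hE : IsElementSet G 𝓔) (h : IsSplit G W W₁ W₂ v)
    {P : Sym2 V → Sym2 V → Prop} (symm : ∀ e f, P e f → P f e)
    (left : ∀ e ∈ 𝓔, ∀ f ∈ 𝓔, Within W₁ e → Within W₁ f → e ≠ f → P e f)
    (right : ∀ e ∈ 𝓔, ∀ f ∈ 𝓔, Within W₂ e → Within W₂ f → e ≠ f → P e f)
    (across : ∀ e ∈ 𝓔, ∀ f ∈ 𝓔, Within W₁ e → Within W₂ f → e ≠ s(v, v) → f ≠ s(v, v) → P e f) :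
    ∀ e ∈ 𝓔, ∀ f ∈ 𝓔, Within W e → Within W f → e ≠ f → P e f := by
  -- The vertex `v` lies on both sides, so a pair containing it counts as a pair within one side.
  have diag₁ : Within W₁ s(v, v) := by simpa using h.mem_left
  have diag₂ : Within W₂ s(v, v) := by simpa using h.mem_right
  have cross : ∀ e ∈ 𝓔, ∀ f ∈ 𝓔, Within W₁ e → Within W₂ f → e ≠ f → P e f := by
    intro e he f hf h1 h2 hne
    by_cases hev : e = s(v, v)
    · exact right e he f hf (hev ▸ diag₂) h2 hne
    · by_cases hfv : f = s(v, v)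
      · exact left e he f hf h1 (hfv ▸ diag₁) hne
      · exact across e he f hf h1 h2 hev hfv
  intro e he f hf heW hfW hne
  rcases hE.within_or h he heW with h1 | h1 <;> rcases hE.within_or h hf hfW with h2 | h2
  · exact left e he f hf h1 h2 hne
  · exact cross e he f hf h1 h2 hne
  · exact symm _ _ (cross f hf e he h2 h1 hne.symm)
  · exact right e he f hf h1 h2 hne

theorem Distinguishes.glue (hG : G.Connected) (hE : IsElementSet G 𝓔) (hr : IsRetraction G W r)
    (h : IsSplit G W W₁ W₂ v) (hw : w ∈ W₁) (d₁ : Distinguishes G 𝓔 W₁ (insert w (insert v T₁)))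
    (d₂ : Distinguishes G 𝓔 W₂ (insert v T₂)) (p₂ : Protects G 𝓔 W₂ v T₂) (hT₂ : T₂ ⊆ W₂)
    (hne : T₂.Nonempty) : Distinguishes G 𝓔 W (insert w (T₁ ∪ T₂)) := by
  refine hE.split_cases h (fun e f ⟨s, hs, h1⟩ => ⟨s, hs, h1.symm⟩) ?_ ?_ ?_
  · intro e he f hf h1 h2 hef
    obtain ⟨s, hs, hs'⟩ := d₁ e he f hf h1 h2 hef
    rcases hs with rfl | rfl | hs
    · exact ⟨_, .inl rfl, hs'⟩
    · obtain ⟨t, ht⟩ := hne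
      exact ⟨t, .inr (.inr ht), edgeDist_ne_of_split hG hr h (hT₂ ht) h1 h2 hs'⟩
    · exact ⟨s, .inr (.inl hs), hs'⟩
  · intro e he f hf h1 h2 hef
    obtain ⟨s, hs, hs'⟩ := d₂ e he f hf h1 h2 hef
    rcases hs with rfl | hs
    · exact ⟨w, .inl rfl, edgeDist_ne_of_split hG hr h.symm hw h1 h2 hs'⟩
    · exact ⟨s, .inr (.inr hs), hs'⟩
  · intro e he f hf h1 h2 _ hfv
    obtain ⟨s, hs, hs'⟩ := p₂.distinguishes_across hG hr h hT₂ h1 h2 hf hfv hw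
    exact ⟨s, hs.imp id .inr, hs'⟩

/-- Protection is asked of `T₁` alone, and `v` itself is not used: each side's landmarks stand in
for `v` on the other side. -/
theorem Distinguishes.glue_root (hG : G.Connected) (hE : IsElementSet G 𝓔)
    (hr : IsRetraction G W r) (h : IsSplit G W W₁ W₂ v)
    (d₁ : Distinguishes G 𝓔 W₁ (insert v T₁)) (p₁ : Protects G 𝓔 W₁ v T₁)
    (d₂ : Distinguishes G 𝓔 W₂ (insert v T₂)) (hT₁ : T₁ ⊆ W₁) (hT₂ : T₂ ⊆ W₂)
    (hne₁ : T₁.Nonempty) (hne₂ : T₂.Nonempty) : Distinguishes G 𝓔 W (T₁ ∪ T₂) := by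
  obtain ⟨t₁, ht₁⟩ := hne₁
  obtain ⟨t₂, ht₂⟩ := hne₂
  refine hE.split_cases h (fun e f ⟨s, hs, h1⟩ => ⟨s, hs, h1.symm⟩) ?_ ?_ ?_
  · intro e he f hf h1 h2 hef
    obtain ⟨s, hs, hs'⟩ := d₁ e he f hf h1 h2 hef
    rcases hs with rfl | hs
    · exact ⟨t₂, .inr ht₂, edgeDist_ne_of_split hG hr h (hT₂ ht₂) h1 h2 hs'⟩
    · exact ⟨s, .inl hs, hs'⟩
  · intro e he f hf h1 h2 hef
    obtain ⟨s, hs, hs'⟩ := d₂ e he f hf h1 h2 hef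
    rcases hs with rfl | hs
    · exact ⟨t₁, .inl ht₁, edgeDist_ne_of_split hG hr h.symm (hT₁ ht₁) h1 h2 hs'⟩
    · exact ⟨s, .inr hs, hs'⟩
  · intro e he f hf h1 h2 hev _
    obtain ⟨s, hs, hs'⟩ := p₁.distinguishes_across hG hr h.symm hT₁ h2 h1 he hev (hT₂ ht₂)
    rcases hs with rfl | hs
    · exact ⟨_, .inr ht₂, hs'.symm⟩
    · exact ⟨s, .inl hs, hs'.symm⟩

/-- If all of `T` sees `e` through `w`, the first vertex after `w` on a shortest path to `e` is one
step further than `w` from every landmark, hence equals `z`. But `z` is closer to `e` than `w` is.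
-/
theorem exists_protecting_of_pos (hG : G.Connected) (hr : IsRetraction G W r) (hw : w ∈ W) {z : V}
    (hz : ∀ u ∈ W, G.Adj w u → (∀ s ∈ T, G.dist s w + 1 ≤ G.dist s u) → u = z) {e : Sym2 V}
    (he : Within W e) (hpos : 0 < edgeDist G w e) :
    ∃ s ∈ insert z T, edgeDist G s e < G.dist s w + edgeDist G w e := by
  by_contra! hcon
  obtain ⟨x, hx, hd⟩ := exists_edgeDist_eq (G := G) w e
  have hwx : w ≠ x := by
    rintro rfl
    simp at hd
    omega
  obtain ⟨u, hu, hwu, hux⟩ := hr.exists_adj_dist_eq hG hw (he x hx) hwx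
  have huz := hz u hu hwu fun s hs => by
    have h1 := hcon s (.inr hs)
    have h2 := edgeDist_le (G := G) s hx
    have h3 := hG.dist_triangle (u := s) (v := u) (w := x)
    omega
  subst huz
  have h1 := hcon u (.inl rfl)
  have h2 := edgeDist_le (G := G) u hx
  omega

/-- Two neighbours of `w` lying behind `w` for all of `T` would be indistinguishable, as would the
two edges joining them to `w`. So there is at most one, and it is taken as `z`; if there is none, `z
= w` is a harmless filler. -/
theorem Distinguishes.exists_protects (hG : G.Connected) (hE : IsElementSet G 𝓔)
    (hr : IsRetraction G W r) (hw : w ∈ W) (d : Distinguishes G 𝓔 W T) :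
    ∃ z ∈ W, Protects G 𝓔 W w (insert z T) := by
  classical
  rcases hE with rfl | rfl
  · have huniq : ∀ u ∈ W, ∀ u' ∈ W, G.Adj w u → G.Adj w u' →
        (∀ s ∈ T, G.dist s w + 1 ≤ G.dist s u) → (∀ s ∈ T, G.dist s w + 1 ≤ G.dist s u') →
        u = u' := by
      intro u hu u' hu' a a' h h'
      by_contra hne
      obtain ⟨s, hs, hs'⟩ := d s(u, u) (by simp) s(u', u') (by simp) (by simpa using hu)
        (by simpa using hu') (by simpa using hne)
      have h1 := h s hs
      have h2 := h' s hs
      have h3 := dist_adj_le hG (x := s) a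
      have h4 := dist_adj_le hG (x := s) a'
      simp only [edgeDist_mk, min_self] at hs'
      omega
    obtain ⟨z, hzW, hz⟩ : ∃ z ∈ W, ∀ u ∈ W, G.Adj w u →
        (∀ s ∈ T, G.dist s w + 1 ≤ G.dist s u) → u = z := by
      by_cases hex : ∃ u ∈ W, G.Adj w u ∧ ∀ s ∈ T, G.dist s w + 1 ≤ G.dist s u
      · obtain ⟨z, hzW, a, h⟩ := hex
        exact ⟨z, hzW, fun u hu a' h' => huniq u hu z hzW a' a h' h⟩
      · exact ⟨w, hw, fun u hu a h => (hex ⟨u, hu, a, h⟩).elim⟩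
    refine ⟨z, hzW, fun e he heW hne => exists_protecting_of_pos hG hr hw hz heW ?_⟩
    induction e using Sym2.ind with
    | h a b =>
      obtain rfl : a = b := by simpa using he
      rw [edgeDist_mk, min_self]
      exact hG.pos_dist_of_ne fun h => hne (by rw [h])
  -- For edges the weaker condition `d(s, w) ≤ d(s, u)` already makes `w` the nearer end of `wu`. It
  -- is needed for the edges at `w`, which have distance 0 from `w`.
  · have huniq : ∀ u ∈ W, ∀ u' ∈ W, G.Adj w u → G.Adj w u' →
        (∀ s ∈ T, G.dist s w ≤ G.dist s u) → (∀ s ∈ T, G.dist s w ≤ G.dist s u') → u = u' := by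
      intro u hu u' hu' a a' h h'
      by_contra hne
      obtain ⟨s, hs, hs'⟩ := d s(w, u) (by simpa using a) s(w, u') (by simpa using a')
        (by simp [hu, hw]) (by simp [hu', hw]) (fun h => hne (Sym2.congr_right.1 h))
      have h1 := h s hs
      have h2 := h' s hs
      simp only [edgeDist_mk] at hs'
      omega
    obtain ⟨z, hzW, hz⟩ : ∃ z ∈ W, ∀ u ∈ W, G.Adj w u →
        (∀ s ∈ T, G.dist s w ≤ G.dist s u) → u = z := by
      by_cases hex : ∃ u ∈ W, G.Adj w u ∧ ∀ s ∈ T, G.dist s w ≤ G.dist s u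
      · obtain ⟨z, hzW, a, h⟩ := hex
        exact ⟨z, hzW, fun u hu a' h' => huniq u hu z hzW a' a h' h⟩
      · exact ⟨w, hw, fun u hu a h => (hex ⟨u, hu, a, h⟩).elim⟩
    refine ⟨z, hzW, fun e he heW _ => ?_⟩
    rcases Nat.eq_zero_or_pos (edgeDist G w e) with h0 | hpos
    · obtain ⟨x, hx, hd⟩ := exists_edgeDist_eq (G := G) w e
      obtain rfl : w = x := (hG.dist_eq_zero_iff).1 (hd ▸ h0)
      obtain ⟨u, rfl⟩ := hx
      rw [within_mk] at heW
      rw [SimpleGraph.mem_edgeSet] at he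
      by_contra! hcon
      have := hz u heW.2 he fun s hs => by
        have := hcon s (.inr hs)
        simp only [edgeDist_mk, SimpleGraph.dist_self] at this
        omega
      subst this
      have h1 := hcon u (.inl rfl)
      have h2 := hG.pos_dist_of_ne he.ne'
      simp only [edgeDist_mk, SimpleGraph.dist_self] at h1
      omega
    · exact exists_protecting_of_pos hG hr hw
        (fun u hu a h => hz u hu a fun s hs => (Nat.le_succ _).trans (h s hs)) heW hpos

end

/-! ### Landmarks in a cycle -/

section Cycle

variable {G : SimpleGraph V} {𝓔 : Set (Sym2 V)} {W : Set V} {r : V → V} {w a b c : V}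

/-- No vertex of `W` has three neighbours in `W`. -/
def DegreeLeTwo (G : SimpleGraph V) (W : Set V) : Prop :=
  ∀ x ∈ W, ∀ y₁ ∈ W, ∀ y₂ ∈ W, ∀ y₃ ∈ W, G.Adj x y₁ → G.Adj x y₂ → G.Adj x y₃ →
    y₁ = y₂ ∨ y₁ = y₃ ∨ y₂ = y₃

/-- Leaving `w` through `c` there is never a choice: the vertex reached so far has one neighbour
back towards `w`, hence at most one further out. -/
theorem DegreeLeTwo.vertex_unique (h3 : DegreeLeTwo G W) (hG : G.Connected)
    (hr : IsRetraction G W r) (hw : w ∈ W) (hc : c ∈ W) (hwc : G.Adj w c) (m : ℕ) :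
    ∀ x ∈ W, ∀ x' ∈ W, G.dist c x = m → G.dist w x = m + 1 → G.dist c x' = m →
      G.dist w x' = m + 1 → x = x' := by
  induction m with
  | zero =>
    intro x _ x' _ h1 _ h2 _
    rw [hG.dist_eq_zero_iff] at h1 h2
    exact h1.symm.trans h2
  | succ m ih =>
    have pred : ∀ x ∈ W, G.dist c x = m + 1 → G.dist w x = m + 2 →
        ∃ u ∈ W, G.Adj x u ∧ G.dist c u = m ∧ G.dist w u = m + 1 := by
      intro x hx h1 h2
      have hxc : x ≠ c := by rintro rfl; simp at h1
      obtain ⟨u, hu, hxu, hd⟩ := hr.exists_adj_dist_eq hG hx hc hxc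
      rw [SimpleGraph.dist_comm, h1, SimpleGraph.dist_comm] at hd
      have h3 := dist_adj_le hG (x := w) hxu.symm
      have h4 := hG.dist_triangle (u := w) (v := c) (w := u)
      rw [SimpleGraph.dist_eq_one_iff_adj.2 hwc] at h4
      exact ⟨u, hu, hxu, by omega, by omega⟩
    intro x hx x' hx' h1 h2 h1' h2'
    obtain ⟨u, hu, hxu, hu1, hu2⟩ := pred x hx h1 h2
    obtain ⟨u', hu', hxu', hu1', hu2'⟩ := pred x' hx' h1' h2'
    obtain rfl := ih u hu u' hu' hu1 hu2 hu1' hu2'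
    have huw : u ≠ w := by rintro rfl; simp at hu2
    obtain ⟨p, hp, hup, hd⟩ := hr.exists_adj_dist_eq hG hu hw huw
    rw [SimpleGraph.dist_comm, hu2, SimpleGraph.dist_comm] at hd
    rcases h3 u hu x hx x' hx' p hp hxu.symm hxu'.symm hup with h | rfl | rfl
    · exact h
    · omega
    · omega

theorem DegreeLeTwo.element_unique (h3 : DegreeLeTwo G W) (hG : G.Connected)
    (hE : IsElementSet G 𝓔) (hr : IsRetraction G W r) (hw : w ∈ W) (hc : c ∈ W)
    (hwc : G.Adj w c) {m : ℕ} {e f : Sym2 V} (he : e ∈ 𝓔) (hf : f ∈ 𝓔) (heW : Within W e)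
    (hfW : Within W f) (he1 : edgeDist G c e = m) (he2 : edgeDist G w e = m + 1)
    (hf1 : edgeDist G c f = m) (hf2 : edgeDist G w f = m + 1) : e = f := by
  have near : ∀ g : Sym2 V, edgeDist G c g = m → edgeDist G w g = m + 1 →
      ∃ x ∈ g, G.dist c x = m ∧ G.dist w x = m + 1 := by
    intro g h1 h2
    obtain ⟨x, hx, hd⟩ := exists_edgeDist_eq (G := G) c g
    have h4 := edgeDist_le (G := G) w hx
    have h5 := hG.dist_triangle (u := w) (v := c) (w := x)
    rw [SimpleGraph.dist_eq_one_iff_adj.2 hwc] at h5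
    exact ⟨x, hx, by omega, by omega⟩
  obtain ⟨x, hx, hx1, hx2⟩ := near e he1 he2
  obtain ⟨x', hx', hx1', hx2'⟩ := near f hf1 hf2
  obtain rfl := h3.vertex_unique hG hr hw hc hwc m x (heW x hx) x' (hfW x' hx') hx1 hx2 hx1' hx2'
  obtain ⟨y, rfl⟩ := hx
  obtain ⟨y', rfl⟩ := hx'
  rcases hE with rfl | rfl
  · obtain rfl : x = y := by simpa using he
    obtain rfl : x = y' := by simpa using hf
    rfl
  · rw [SimpleGraph.mem_edgeSet] at he hf
    rw [within_mk] at heW hfW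
    have hxw : x ≠ w := by rintro rfl; simp at hx2
    obtain ⟨p, hp, hxp, hd⟩ := hr.exists_adj_dist_eq hG heW.1 hw hxw
    rw [SimpleGraph.dist_comm, hx2, SimpleGraph.dist_comm] at hd
    simp only [edgeDist_mk] at he2 hf2
    rcases h3 x heW.1 y heW.2 y' hfW.2 p hp he hf hxp with h | rfl | rfl
    · rw [h]
    · omega
    · omega

theorem exists_step_edgeDist (hG : G.Connected) (hr : IsRetraction G W r) (hw : w ∈ W)
    (hN : ∀ u ∈ W, G.Adj w u → u = a ∨ u = b) {e : Sym2 V} (heW : Within W e) {m : ℕ}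
    (he : edgeDist G w e = m + 1) :
    (G.Adj w a ∧ edgeDist G a e = m) ∨ (G.Adj w b ∧ edgeDist G b e = m) := by
  obtain ⟨x, hx, hd⟩ := exists_edgeDist_eq (G := G) w e
  have hwx : w ≠ x := by rintro rfl; simp at hd; omega
  obtain ⟨u, hu, hwu, hux⟩ := hr.exists_adj_dist_eq hG hw (heW x hx) hwx
  have h1 := edgeDist_le (G := G) u hx
  have h2 := edgeDist_le_add hG w u e
  rw [SimpleGraph.dist_eq_one_iff_adj.2 hwu] at h2
  have h3 : edgeDist G u e = m := by omega
  rcases hN u hu hwu with rfl | rfl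
  · exact .inl ⟨hwu, h3⟩
  · exact .inr ⟨hwu, h3⟩

theorem DegreeLeTwo.distinguishes (h3 : DegreeLeTwo G W) (hG : G.Connected)
    (hE : IsElementSet G 𝓔) (hr : IsRetraction G W r) (hw : w ∈ W) (ha : a ∈ W) (hb : b ∈ W)
    (hwa : G.Adj w a) (hwb : G.Adj w b) (hab : a ≠ b)
    (hN : ∀ u ∈ W, G.Adj w u → u = a ∨ u = b) : Distinguishes G 𝓔 W {w, a} := by
  intro e he f hf heW hfW hef
  by_contra! hcon
  have hw' := hcon w (by simp)
  have ha' := hcon a (by simp)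
  apply hef
  rcases hm : edgeDist G w e with _ | m
  · have zero : ∀ g : Sym2 V, edgeDist G w g = 0 → w ∈ g := by
      intro g hg
      obtain ⟨x, hx, hd⟩ := exists_edgeDist_eq (G := G) w g
      obtain rfl : w = x := (hG.dist_eq_zero_iff).1 (hd ▸ hg)
      exact hx
    obtain ⟨y, rfl⟩ := zero e hm
    obtain ⟨y', rfl⟩ := zero f (hw' ▸ hm)
    rcases hE with rfl | rfl
    · obtain rfl : w = y := by simpa using he
      obtain rfl : w = y' := by simpa using hf
      rfl
    · rw [SimpleGraph.mem_edgeSet] at he hf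
      rw [within_mk] at heW hfW
      have h1 := hG.pos_dist_of_ne hab
      have h2 := hG.pos_dist_of_ne hwa.ne'
      simp only [edgeDist_mk] at ha'
      rcases hN y heW.2 he with rfl | rfl <;> rcases hN y' hfW.2 hf with rfl | rfl
      · rfl
      · simp only [SimpleGraph.dist_self] at ha'
        omega
      · simp only [SimpleGraph.dist_self] at ha'
        omega
      · rfl
  · have hm' := hw' ▸ hm
    -- Equal distances from `a` mean that `e` and `f` are both reached from `w` through `a`, or both
    -- only through `b`.
    by_cases hea : edgeDist G a e = m
    · exact h3.element_unique hG hE hr hw ha hwa he hf heW hfW hea hm (ha' ▸ hea) hm'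
    · have h1 := (exists_step_edgeDist hG hr hw hN heW hm).resolve_left fun h => hea h.2
      have h2 := (exists_step_edgeDist hG hr hw hN hfW hm').resolve_left fun h =>
        hea (ha'.trans h.2)
      exact h3.element_unique hG hE hr hw hb hwb he hf heW hfW h1.2 hm h2.2 hm'

theorem protects_of_neighbors (hG : G.Connected) (hE : IsElementSet G 𝓔)
    (hr : IsRetraction G W r) (hw : w ∈ W) (hN : ∀ u ∈ W, G.Adj w u → u = a ∨ u = b) :
    Protects G 𝓔 W w {a, b} := by
  intro e he heW hew
  rcases hm : edgeDist G w e with _ | m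
  · obtain ⟨x, hx, hd⟩ := exists_edgeDist_eq (G := G) w e
    obtain rfl : w = x := (hG.dist_eq_zero_iff).1 (hd ▸ hm)
    obtain ⟨y, rfl⟩ := hx
    rw [within_mk] at heW
    have hwy : G.Adj w y := (hE.eq_or_adj he).resolve_left fun h => hew (by rw [h])
    refine ⟨y, hN y heW.2 hwy, ?_⟩
    have := hG.pos_dist_of_ne hwy.ne'
    simp only [edgeDist_mk, SimpleGraph.dist_self]
    omega
  · rcases exists_step_edgeDist hG hr hw hN heW hm with ⟨-, h⟩ | ⟨-, h⟩
    · exact ⟨a, by simp, by omega⟩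
    · exact ⟨b, by simp, by omega⟩

end Cycle

/-! ### Consequences of 2-connectedness -/

section TwoConnected

variable {X : Type u} {H : SimpleGraph X}

theorem of_preconnected_of_adj (hH : H.Preconnected) {P : X → Prop}
    (hP : ∀ a b, H.Adj a b → P a → P b) {x : X} (hx : P x) (y : X) : P y := by
  obtain ⟨p⟩ := hH x y
  induction p with
  | nil => exact hx
  | cons h p ih => exact ih (hP _ _ h hx)

theorem isKConnected_iff [Finite X] {k : ℕ} :
    IsKConnected k H ↔ ∀ S : Finset X, IsVertexCut H (S : Set X) → k ≤ S.card := by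
  constructor
  · exact fun h S hS => le_trans h (Nat.sInf_le ⟨S, rfl, hS⟩)
  · intro h
    have := Fintype.ofFinite X
    -- The whole vertex set is a cut, so the infimum is attained and is not the default value 0.
    have hne : {n | ∃ S : Finset X, S.card = n ∧ IsVertexCut H (S : Set X)}.Nonempty :=
      ⟨_, Finset.univ, rfl, .inr (by simp)⟩
    obtain ⟨S, hS, hc⟩ := Nat.sInf_mem hne
    exact (h S hc).trans hS.le

theorem IsKConnected.of_card_le_one [Finite X] (h : IsKConnected 2 H) {S : Finset X}
    (hS : S.card ≤ 1) :
    (H.induce (S : Set X)ᶜ).Preconnected ∧ ((S : Set X)ᶜ).Nontrivial := by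
  have h1 : ¬ IsVertexCut H (S : Set X) := fun hc => by
    have := isKConnected_iff.1 h S hc
    omega
  rw [IsVertexCut, not_or, not_not, Set.not_subsingleton_iff] at h1
  exact h1

theorem IsKConnected.preconnected [Finite X] (h : IsKConnected 2 H) : H.Preconnected := by
  have h1 := (h.of_card_le_one (S := ∅) (by simp)).1
  intro x y
  have h2 := h1 ⟨x, by simp⟩ ⟨y, by simp⟩
  exact h2.map (SimpleGraph.Embedding.induce _).toHom

theorem IsKConnected.exists_triple [Finite X] (h : IsKConnected 2 H) :
    ∃ a b c : X, a ≠ b ∧ a ≠ c ∧ b ≠ c := by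
  obtain ⟨a, -, -⟩ := (h.of_card_le_one (S := ∅) (by simp)).2
  obtain ⟨b, hb, c, hc, hbc⟩ := (h.of_card_le_one (S := {a}) (by simp)).2
  exact ⟨a, b, c, by simpa [eq_comm] using hb, by simpa [eq_comm] using hc, hbc⟩

theorem IsKConnected.connected [Finite X] (h : IsKConnected 2 H) : H.Connected := by
  obtain ⟨a, -⟩ := h.exists_triple
  exact (SimpleGraph.connected_iff H).2 ⟨h.preconnected, ⟨a⟩⟩

theorem IsKConnected.two_le_minDegree [Fintype X] [DecidableRel H.Adj] (h : IsKConnected 2 H) :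
    2 ≤ H.minDegree := by
  have := h.connected.nonempty
  refine SimpleGraph.le_minDegree_of_forall_le_degree _ _ fun v => ?_
  by_contra! hlt
  -- Deleting at most one neighbour would isolate `v` while leaving another vertex.
  obtain ⟨h1, h2⟩ := h.of_card_le_one (S := H.neighborFinset v) (by
    rw [SimpleGraph.card_neighborFinset_eq_degree]; omega)
  obtain ⟨y, hy, hyv⟩ := h2.exists_ne v
  refine hyv (of_preconnected_of_adj h1 (P := fun z => z.1 = v) ?_
    (x := ⟨v, by simp⟩) rfl ⟨y, hy⟩)
  rintro ⟨a, ha⟩ ⟨b, hb⟩ hab (rfl : a = v)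
  simp only [Set.mem_compl_iff, Finset.mem_coe, SimpleGraph.mem_neighborFinset] at hb
  exact absurd hab hb

end TwoConnected

/-! ### Blocks as 2-connected retracts, and splitting at a cut vertex -/

section Blocks

variable [Finite V] {G : SimpleGraph V} {W : Set V} {r : V → V}

/-- A vertex `x` of `K` outside `W` is separated from `W` by `r x`: after deleting `r x`, the
vertices collapsing to it are closed under adjacency. Since `K` has two vertices in `W`, one of them
survives, against 2-connectedness. This makes a 2-connected retract a maximal 2-connected subgraph.
-/
theorem IsRetraction.verts_subset (hr : IsRetraction G W r) {K : G.Subgraph}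
    (hK : IsKConnected 2 K.coe) {a b : V} (ha : a ∈ K.verts) (hb : b ∈ K.verts) (haW : a ∈ W)
    (hbW : b ∈ W) (hab : a ≠ b) : K.verts ⊆ W := by
  intro x hx
  by_contra hxW
  let S : Finset K.verts := (Set.toFinite {y : K.verts | y.1 = r x}).toFinset
  have hS : ∀ y, y ∈ S ↔ y.1 = r x := fun y => by simp [S]
  have hcard : S.card ≤ 1 := by
    rw [Finset.card_le_one]
    intro y hy z hz
    rw [hS] at hy hz
    exact Subtype.ext (hy.trans hz.symm)
  have h1 := (hK.of_card_le_one hcard).1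
  have hx' : (⟨x, hx⟩ : K.verts) ∈ ((S : Set K.verts)ᶜ) := by
    intro h
    have h2 : x = r x := (hS _).1 h
    exact hxW (h2 ▸ hr.mem x)
  obtain ⟨c, hcK, hcW, hc⟩ : ∃ c ∈ K.verts, c ∈ W ∧ c ≠ r x := by
    by_cases h : a = r x
    · exact ⟨b, hb, hbW, h ▸ hab.symm⟩
    · exact ⟨a, ha, haW, h⟩
  have hc' : (⟨c, hcK⟩ : K.verts) ∈ ((S : Set K.verts)ᶜ) := fun h => hc ((hS _).1 h)
  have h3 := of_preconnected_of_adj h1 (P := fun z => r z.1.1 = r x) (by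
    rintro ⟨⟨y, hyK⟩, hy⟩ ⟨⟨z, hzK⟩, hz⟩ hyz (h : r y = r x)
    have hadj : G.Adj y z := K.adj_sub hyz
    rcases hr.adj hadj with e | ⟨hyW, -⟩
    · exact e.symm.trans h
    · rw [hr.fix y hyW] at h
      exact (hy ((hS _).2 h)).elim) (x := ⟨⟨x, hx⟩, hx'⟩) rfl ⟨⟨c, hcK⟩, hc'⟩
  exact hc ((hr.fix c hcW).symm.trans h3)

theorem two_lt_ncard_of_isKConnected {W : Set V} (hk : IsKConnected 2 (G.induce W)) :
    2 < W.ncard := by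
  obtain ⟨a, b, c, hab, hac, hbc⟩ := hk.exists_triple
  exact (Set.two_lt_ncard_iff).2 ⟨a, b, c, a.2, b.2, c.2, Subtype.coe_ne_coe.2 hab,
    Subtype.coe_ne_coe.2 hac, Subtype.coe_ne_coe.2 hbc⟩

theorem IsRetraction.isNontrivialBlock (hr : IsRetraction G W r)
    (h : IsKConnected 2 (G.induce W)) :
    IsNontrivialBlock ((⊤ : G.Subgraph).induce W) := by
  obtain ⟨a, b, c, hab, hac, hbc⟩ := h.exists_triple
  refine ⟨⟨?_, fun K hK hle => ⟨?_, ?_⟩⟩, ?_⟩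
  · have e := SimpleGraph.induce_eq_coe_induce_top (G := G) W
    change IsKConnected (V := W) 2 ((⊤ : G.Subgraph).induce W).coe
    rwa [← e]
  · exact hr.verts_subset hK (hle.1 a.2) (hle.1 b.2) a.2 b.2 (Subtype.coe_ne_coe.2 hab)
  · intro x y hxy
    have hW := hr.verts_subset hK (hle.1 a.2) (hle.1 b.2) a.2 b.2 (Subtype.coe_ne_coe.2 hab)
    exact ⟨hW (K.edge_vert hxy), hW (K.edge_vert hxy.symm), K.adj_sub hxy⟩
  · exact two_lt_ncard_of_isKConnected h

theorem exists_isSplit (hW : (G.induce W).Preconnected) (h3 : 2 < W.ncard)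
    (hk : ¬ IsKConnected 2 (G.induce W)) {w : V} (hw : w ∈ W) :
    ∃ W₁ W₂ v, IsSplit G W W₁ W₂ v ∧ w ∈ W₁ := by
  rw [isKConnected_iff] at hk
  push Not at hk
  obtain ⟨S, hS, hlt⟩ := hk
  have hnt : ¬ ((S : Set W)ᶜ).Subsingleton := by
    intro hsub
    have h1 := Set.ncard_le_one_iff_subsingleton.2 hsub
    have h2 := Set.ncard_add_ncard_compl (S : Set W)
    rw [Set.ncard_coe_finset, Nat.card_coe_set_eq] at h2
    omega
  have hdis := hS.resolve_right hnt
  rw [SimpleGraph.Preconnected] at hdis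
  push Not at hdis
  obtain ⟨x, y, hxy⟩ := hdis
  obtain ⟨v, rfl⟩ : ∃ v, S = {v} := by
    rw [← Finset.card_eq_one]
    rcases Nat.eq_zero_or_pos S.card with h0 | hpos
    · exfalso
      rw [Finset.card_eq_zero] at h0
      subst h0
      refine hS.resolve_right hnt ?_
      let f : G.induce W →g (G.induce W).induce ((∅ : Finset W) : Set W)ᶜ :=
        ⟨fun z => ⟨z, by simp⟩, fun h => h⟩
      intro a b
      exact (hW a.1 b.1).map f
    · omega
  -- The component of `x` after deleting `v`; the two sides are `C` with `v` added back and
  -- everything outside `C`.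
  let C : Set V := {z | ∃ (h : z ∈ W) (h' : (⟨z, h⟩ : W) ∈ ((({v} : Finset W) : Set W)ᶜ)),
    ((G.induce W).induce ((({v} : Finset W) : Set W)ᶜ)).Reachable x ⟨⟨z, h⟩, h'⟩}
  have hCW : C ⊆ W := fun z ⟨h, _⟩ => h
  have hvC : v.1 ∉ C := fun ⟨_, h', _⟩ => h' (by simp)
  have hxC : x.1.1 ∈ C := ⟨x.1.2, x.2, .rfl⟩
  have hyC : y.1.1 ∉ C := fun ⟨_, _, h⟩ => hxy h
  have hyv : y.1.1 ≠ v.1 := fun h => y.2 (by simp [Subtype.ext_iff, h])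
  have hC : ∀ a ∈ C, ∀ b ∈ W, b ∉ C → b ≠ v.1 → ¬ G.Adj a b := by
    rintro a ⟨ha, ha', hr⟩ b hb hbC hbv hab
    refine hbC ⟨hb, by simpa [Subtype.ext_iff] using hbv, hr.trans (SimpleGraph.Adj.reachable ?_)⟩
    exact hab
  have split : IsSplit G W (W \ C) (insert v.1 C) v.1 := by
    refine ⟨?_, ?_, ?_, ⟨y.1.1, ⟨y.1.2, hyC⟩, hyv⟩, ⟨x.1.1, .inr hxC, fun h => hvC (h ▸ hxC)⟩⟩
    · ext z
      constructor
      · rintro (h | rfl | h)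
        exacts [h.1, v.2, hCW h]
      · intro h
        by_cases hz : z ∈ C
        exacts [.inr (.inr hz), .inl ⟨h, hz⟩]
    · ext z
      constructor
      · rintro ⟨h, rfl | h'⟩
        exacts [rfl, (h.2 h').elim]
      · rintro rfl
        exact ⟨⟨v.2, hvC⟩, .inl rfl⟩
    · rintro a ⟨ha, haC⟩ b (rfl | hb) hab
      · exact .inr rfl
      · by_contra! hne
        exact hC b hb a ha haC hne.1 hab.symm
  by_cases hwC : w ∈ C
  · exact ⟨_, _, _, split.symm, .inr hwC⟩
  · exact ⟨_, _, _, split, hw, hwC⟩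

end Blocks

/-! ### Neighbours and cyclomatic number of a cycle -/

section Cycles

theorem IsCycleGraph.neighbors {X : Type u} {H : SimpleGraph X} (h : IsCycleGraph H) (w : X) :
    ∃ a b, a ≠ b ∧ H.Adj w a ∧ H.Adj w b ∧ ∀ u, H.Adj w u → u = a ∨ u = b := by
  obtain ⟨n, hn, ⟨f⟩⟩ := h
  obtain ⟨n, rfl⟩ := Nat.exists_eq_add_of_le' hn
  have h2 : ((SimpleGraph.cycleGraph (n + 3)).neighborFinset (f w)).card = 2 := by
    rw [SimpleGraph.card_neighborFinset_eq_degree, SimpleGraph.cycleGraph_degree_three_le]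
  obtain ⟨a, b, hab, he⟩ := Finset.card_eq_two.1 h2
  have hmem : ∀ u, H.Adj w u ↔ f u = a ∨ f u = b := by
    intro u
    rw [← f.map_adj_iff, ← SimpleGraph.mem_neighborFinset, he]
    simp
  refine ⟨f.symm a, f.symm b, by simpa using hab, (hmem _).2 (by simp), (hmem _).2 (by simp),
    fun u hu => ?_⟩
  rcases (hmem u).1 hu with rfl | rfl <;> simp

theorem IsCycleGraph.cyclomatic_eq {X : Type u} {H : SimpleGraph X} (h : IsCycleGraph H) :
    cyclomatic H = 1 := by
  obtain ⟨n, hn, ⟨f⟩⟩ := h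
  obtain ⟨n, rfl⟩ := Nat.exists_eq_add_of_le' hn
  have h1 : H.edgeSet.ncard = (SimpleGraph.cycleGraph (n + 3)).edgeFinset.card := by
    rw [← Nat.card_coe_set_eq, Nat.card_congr f.mapEdgeSet, Nat.card_eq_fintype_card,
      SimpleGraph.edgeFinset_card]
  have h2 : Nat.card X = n + 3 := by simp [Nat.card_congr f.toEquiv]
  have h3 := (SimpleGraph.cycleGraph (n + 3)).sum_degrees_eq_twice_card_edges
  simp only [SimpleGraph.cycleGraph_degree_three_le, Finset.sum_const, Finset.card_univ,
    Fintype.card_fin, smul_eq_mul] at h3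
  rw [cyclomatic, h1, h2]
  omega

theorem cyclomatic_induce (G : SimpleGraph V) (W : Set V) :
    cyclomatic (G.induce W) = cyc G W := by
  have h : {e | e ∈ G.edgeSet ∧ Within W e} = Sym2.map Subtype.val '' (G.induce W).edgeSet := by
    ext e
    induction e using Sym2.ind with
    | h a b =>
      constructor
      · rintro ⟨h1, h2⟩
        rw [within_mk] at h2
        exact ⟨s(⟨a, h2.1⟩, ⟨b, h2.2⟩), h1, rfl⟩
      · rintro ⟨e, he, hab⟩
        induction e using Sym2.ind with
        | h x y =>
          rw [Sym2.map_mk] at hab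
          rw [← hab]
          exact ⟨he, by simp⟩
  rw [cyclomatic, cyc, h, Set.ncard_image_of_injective _ (Sym2.map.injective Subtype.val_injective),
    Nat.card_coe_set_eq]

end Cycles

/-! ### Counting landmarks over the whole graph -/

section Reduction

variable [Finite V] {G : SimpleGraph V} {𝓔 : Set (Sym2 V)}

/-- Every non-trivial block which is not a cycle has a generator with at most `2c - 1` vertices. -/
def BlockBound (G : SimpleGraph V) (𝓔 : Set (Sym2 V)) : Prop :=
  ∀ (W : Set V) (r : V → V), IsRetraction G W r → IsKConnected 2 (G.induce W) →
    ¬ IsCycleGraph (G.induce W) →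
    ∃ T ⊆ W, (T.ncard : ℤ) ≤ 2 * cyc G W - 1 ∧ Distinguishes G 𝓔 W T

omit [Finite V] in
theorem IsCycleGraph.degreeLeTwo {W : Set V} (h : IsCycleGraph (G.induce W)) :
    DegreeLeTwo G W := by
  intro x hx y₁ h₁ y₂ h₂ y₃ h₃ a₁ a₂ a₃
  obtain ⟨a, b, -, -, -, hN⟩ := h.neighbors ⟨x, hx⟩
  have e₁ := hN ⟨y₁, h₁⟩ a₁
  have e₂ := hN ⟨y₂, h₂⟩ a₂
  have e₃ := hN ⟨y₃, h₃⟩ a₃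
  simp only [Subtype.ext_iff] at e₁ e₂ e₃
  grind

omit [Finite V] in
theorem BlockBound.exists_protecting (hb : BlockBound G 𝓔) (hG : G.Connected)
    (hE : IsElementSet G 𝓔) {W : Set V} {r : V → V} (hr : IsRetraction G W r)
    (hk : IsKConnected 2 (G.induce W)) {w : V} (hw : w ∈ W) :
    ∃ S ⊆ W, (S.ncard : ℤ) ≤ 2 * cyc G W ∧ Distinguishes G 𝓔 W (insert w S) ∧
      Protects G 𝓔 W w S := by
  by_cases hc : IsCycleGraph (G.induce W)
  · obtain ⟨a, b, hab, hwa, hwb, hN⟩ := hc.neighbors ⟨w, hw⟩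
    have hN' : ∀ u ∈ W, G.Adj w u → u = a.1 ∨ u = b.1 := fun u hu h =>
      (hN ⟨u, hu⟩ h).imp (congrArg Subtype.val) (congrArg Subtype.val)
    refine ⟨{a.1, b.1}, ?_, ?_, ?_, protects_of_neighbors hG hE hr hw hN'⟩
    · rintro x (rfl | rfl)
      exacts [a.2, b.2]
    · rw [← cyclomatic_induce, hc.cyclomatic_eq]
      have := Set.ncard_insert_le a.1 {b.1}
      rw [Set.ncard_singleton] at this
      omega
    · refine (hc.degreeLeTwo.distinguishes hG hE hr hw a.2 b.2 hwa hwb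
        (Subtype.coe_ne_coe.2 hab) hN').mono ?_
      rintro x (rfl | rfl)
      exacts [.inl rfl, .inr (.inl rfl)]
  · obtain ⟨T, hT, hcard, d⟩ := hb W r hr hk hc
    obtain ⟨z, hz, p⟩ := d.exists_protects hG hE hr hw
    refine ⟨insert z T, Set.insert_subset hz hT, ?_,
      d.mono ((Set.subset_insert _ _).trans (Set.subset_insert _ _)), p⟩
    have := Set.ncard_insert_le z T
    omega

theorem IsElementSet.exists_ne_within (hE : IsElementSet G 𝓔) (hG : G.Connected) {W : Set V}
    {r : V → V} (hr : IsRetraction G W r) (hW : 2 < W.ncard) :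
    ∃ e ∈ 𝓔, ∃ f ∈ 𝓔, Within W e ∧ Within W f ∧ e ≠ f := by
  obtain ⟨a, b, c, ha, hb, hc, hab, hac, hbc⟩ := (Set.two_lt_ncard_iff).1 hW
  rcases hE with rfl | rfl
  · exact ⟨s(a, a), by simp, s(b, b), by simp, by simpa using ha, by simpa using hb,
      by simpa using hab⟩
  · obtain ⟨u, hu, hau, -⟩ := hr.exists_adj_dist_eq hG ha hb hab
    obtain ⟨y, hy, hya, hyu⟩ : ∃ y ∈ W, y ≠ a ∧ y ≠ u := by
      by_cases h : b = u
      · exact ⟨c, hc, hac.symm, h ▸ hbc.symm⟩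
      · exact ⟨b, hb, hab.symm, h⟩
    obtain ⟨p, hp, hyp, -⟩ := hr.exists_adj_dist_eq hG hy ha hya
    refine ⟨s(a, u), hau, s(y, p), hyp, by simp [ha, hu], by simp [hy, hp], fun h => ?_⟩
    have : y ∈ s(a, u) := h ▸ Sym2.mem_mk_left y p
    rw [Sym2.mem_iff] at this
    exact this.elim hya hyu

/-- Without protection one landmark fewer is enough, also for a cycle: one neighbour of the root
together with the root. -/
theorem BlockBound.exists_rooted (hb : BlockBound G 𝓔) (hG : G.Connected)
    (hE : IsElementSet G 𝓔) {W : Set V} {r : V → V} (hr : IsRetraction G W r)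
    (hk : IsKConnected 2 (G.induce W)) {w : V} (hw : w ∈ W) :
    ∃ S ⊆ W, S.Nonempty ∧ (S.ncard : ℤ) ≤ 2 * cyc G W - 1 ∧
      Distinguishes G 𝓔 W (insert w S) := by
  by_cases hc : IsCycleGraph (G.induce W)
  · obtain ⟨a, b, hab, hwa, hwb, hN⟩ := hc.neighbors ⟨w, hw⟩
    refine ⟨{a.1}, by simp, by simp, ?_, hc.degreeLeTwo.distinguishes hG hE hr hw a.2 b.2 hwa hwb
        (Subtype.coe_ne_coe.2 hab) fun u hu h =>
      (hN ⟨u, hu⟩ h).imp (congrArg Subtype.val) (congrArg Subtype.val)⟩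
    rw [← cyclomatic_induce, hc.cyclomatic_eq, Set.ncard_singleton]
    norm_num
  · obtain ⟨T, hT, hcard, d⟩ := hb W r hr hk hc
    obtain ⟨e, he, f, hf, heW, hfW, hne⟩ :=
      hE.exists_ne_within hG hr (two_lt_ncard_of_isKConnected hk)
    obtain ⟨s, hs, -⟩ := d e he f hf heW hfW hne
    exact ⟨T, hT, ⟨s, hs⟩, hcard, d.mono (Set.subset_insert _ _)⟩

theorem cyc_nonneg_of_ncard_le_two (hG : G.Connected) {W : Set V} {r : V → V}
    (hr : IsRetraction G W r) (hW : W.ncard ≤ 2) : 0 ≤ cyc G W := by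
  unfold cyc
  by_cases h1 : W.ncard ≤ 1
  · omega
  · obtain ⟨a, ha, b, hb, hab⟩ := (Set.one_lt_ncard_iff_nontrivial).1 (not_le.1 h1)
    obtain ⟨u, hu, hau, -⟩ := hr.exists_adj_dist_eq hG ha hb hab
    have : 0 < {e | e ∈ G.edgeSet ∧ Within W e}.ncard :=
      (Set.ncard_pos).2 ⟨s(a, u), hau, by simp [ha, hu]⟩
    omega

omit [Finite V] in
theorem IsElementSet.small (hE : IsElementSet G 𝓔) (hG : G.Connected) {W T : Set V} {w x : V}
    (hW : W ⊆ {w, x}) (hT : x ∈ T) (hxw : x ≠ w) :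
    Distinguishes G 𝓔 W (insert w T) ∧ Protects G 𝓔 W w T := by
  have hpos := hG.pos_dist_of_ne hxw
  have hpos' := hG.pos_dist_of_ne hxw.symm
  have cases : ∀ e ∈ 𝓔, Within W e → e = s(w, w) ∨ e = s(x, x) ∨ e = s(w, x) := by
    intro e _ he
    induction e using Sym2.ind with
    | h a b =>
      rw [within_mk] at he
      rcases hW he.1 with rfl | rfl <;> rcases hW he.2 with rfl | rfl
      exacts [.inl rfl, .inr (.inr rfl), .inr (.inr Sym2.eq_swap), .inr (.inl rfl)]
  have not_both : ∀ y, s(w, x) ∈ 𝓔 → s(y, y) ∉ 𝓔 := by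
    intro y h h'
    rcases hE with rfl | rfl
    · exact hxw.symm (by simpa using h)
    · simp at h'
  constructor
  · intro e he f hf heW hfW hne
    refine ⟨w, .inl rfl, ?_⟩
    rcases cases e he heW with rfl | rfl | rfl <;> rcases cases f hf hfW with rfl | rfl | rfl <;>
      first
      | exact absurd rfl hne
      | exact absurd he (not_both _ hf)
      | exact absurd hf (not_both _ he)
      | (simp only [edgeDist_mk, SimpleGraph.dist_self]; omega)
  · intro e he heW hne
    refine ⟨x, hT, ?_⟩
    rcases cases e he heW with rfl | rfl | rfl
    · exact absurd rfl hne
    all_goals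
      simp only [edgeDist_mk, SimpleGraph.dist_self]
      omega

/-- A rooted piece all of whose vertices, except the root and those in `A`, have two neighbours in
the piece, has a generator with `2c` vertices besides `A` and the root. -/
theorem BlockBound.exists_protecting_of_degree (hb : BlockBound G 𝓔) (hG : G.Connected)
    (hE : IsElementSet G 𝓔) (n : ℕ) : ∀ (W : Set V) (r : V → V) (w : V) (A : Set V),
      W.ncard = n → IsRetraction G W r → w ∈ W →
      (∀ x ∈ W, x ≠ w → x ∉ A → ∃ y ∈ W, ∃ z ∈ W, y ≠ z ∧ G.Adj x y ∧ G.Adj x z) →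
      ∃ S ⊆ W, (S.ncard : ℤ) ≤ 2 * cyc G W ∧ Distinguishes G 𝓔 W (insert w (S ∪ A ∩ W)) ∧
        Protects G 𝓔 W w (S ∪ A ∩ W) := by
  induction n using Nat.strong_induction_on with
  | h n ih =>
    intro W r w A hn hr hw hdeg
    by_cases hsmall : W.ncard ≤ 2
    · refine ⟨∅, by simp, by simpa using cyc_nonneg_of_ncard_le_two hG hr hsmall, ?_⟩
      rw [Set.empty_union]
      by_cases hx : ∃ x ∈ W, x ≠ w
      · obtain ⟨x, hx, hxw⟩ := hx
        have hW : W ⊆ {w, x} := by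
          have h1 : ({w, x} : Set V) ⊆ W := by
            rintro y (rfl | rfl) <;> assumption
          rw [Set.eq_of_subset_of_ncard_le h1 (by rwa [Set.ncard_pair hxw.symm])]
        refine hE.small hG hW ⟨?_, hx⟩ hxw
        -- Outside `A`, the vertex `x` would need two neighbours within `{w, x}`.
        by_contra hxA
        obtain ⟨y, hy, z, hz, hyz, ay, az⟩ := hdeg x hx hxw hxA
        have h1 := (hW hy).resolve_right ay.ne'
        have h2 := (hW hz).resolve_right az.ne'
        exact hyz (h1.trans (Eq.symm h2))
      · push Not at hx
        have only : ∀ e, Within W e → e = s(w, w) := by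
          intro e he
          induction e using Sym2.ind with
          | h a b =>
            rw [within_mk] at he
            rw [hx a he.1, hx b he.2]
        exact ⟨fun e _ f _ heW hfW hne => absurd ((only e heW).trans (only f hfW).symm) hne,
          fun e _ heW hne => absurd (only e heW) hne⟩
    · by_cases hk : IsKConnected 2 (G.induce W)
      · obtain ⟨S, hS, hcard, d, p⟩ := hb.exists_protecting hG hE hr hk hw
        exact ⟨S, hS, hcard, d.mono (Set.insert_subset_insert Set.subset_union_left),
          p.mono Set.subset_union_left⟩
      · obtain ⟨W₁, W₂, v, h, hw₁⟩ :=
          exists_isSplit (hr.connected hG).preconnected (not_le.1 hsmall) hk hw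
        have hr₁ := h.retraction hr
        have hr₂ := h.symm.retraction hr
        -- On the side of `w`, the vertex `v` joins `A`: its neighbours may lie in `W₂`, and it is a
        -- free landmark because the landmarks of `W₂` will replace it.
        obtain ⟨S₁, hS₁, hc₁, d₁, p₁⟩ := ih _ (hn ▸ Set.ncard_lt_ncard h.ssubset_left) W₁ _ w
          (insert v A) rfl hr₁ hw₁ (by
            intro x hx hxw hxA
            rw [Set.mem_insert_iff, not_or] at hxA
            obtain ⟨y, hy, z, hz, hyz, ay, az⟩ := hdeg x (h.left_subset hx) hxw hxA.2
            have key : ∀ y ∈ W, G.Adj x y → y ∈ W₁ := fun y hy a =>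
              ((h.adj_within (h.left_subset hx) hy a).resolve_right
                fun h' => hxA.1 (h.eq hx h'.1)).2
            exact ⟨y, key y hy ay, z, key z hz az, hyz, ay, az⟩)
        obtain ⟨S₂, hS₂, hc₂, d₂, p₂⟩ := ih _ (hn ▸ Set.ncard_lt_ncard h.symm.ssubset_left) W₂ _ v
          A rfl hr₂ h.mem_right (by
            intro x hx hxv hxA
            have hxw : x ≠ w := fun e => hxv (h.eq (e ▸ hw₁) hx)
            obtain ⟨y, hy, z, hz, hyz, ay, az⟩ := hdeg x (h.right_subset hx) hxw hxA
            have key : ∀ y ∈ W, G.Adj x y → y ∈ W₂ := fun y hy a =>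
              ((h.adj_within (h.right_subset hx) hy a).resolve_left
                fun h' => hxv (h.eq h'.1 hx)).2
            exact ⟨y, key y hy ay, z, key z hz az, hyz, ay, az⟩)
        have hA₁ : S₁ ∪ insert v A ∩ W₁ ⊆ insert v (S₁ ∪ A ∩ W₁) := by
          rintro x (hx | ⟨rfl | hx, hx'⟩)
          exacts [.inr (.inl hx), .inl rfl, .inr (.inr ⟨hx, hx'⟩)]
        have hT₂ : S₂ ∪ A ∩ W₂ ⊆ W₂ := Set.union_subset hS₂ Set.inter_subset_right
        have hne := p₂.nonempty hE hG hr₂ h.mem_right h.right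
        have hunion : S₁ ∪ A ∩ W₁ ∪ (S₂ ∪ A ∩ W₂) ⊆ S₁ ∪ S₂ ∪ A ∩ W := by
          rintro x ((hx | hx) | (hx | hx))
          exacts [.inl (.inl hx), .inr ⟨hx.1, h.left_subset hx.2⟩, .inl (.inr hx),
            .inr ⟨hx.1, h.right_subset hx.2⟩]
        refine ⟨S₁ ∪ S₂, Set.union_subset (hS₁.trans h.left_subset) (hS₂.trans h.right_subset),
          ?_, ?_, ?_⟩
        · have := Set.ncard_union_le S₁ S₂
          rw [h.cyc_add]
          omega
        · exact (Distinguishes.glue hG hE hr h hw₁ (d₁.mono (Set.insert_subset_insert hA₁)) d₂ p₂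
            hT₂ hne).mono (Set.insert_subset_insert hunion)
        · exact (Protects.glue hG hE hr h hw₁ (p₁.mono hA₁) p₂ hT₂ hne).mono hunion

omit [Finite V] in
theorem IsSplit.refine {W₁ W₂ Wa Wb : Set V} {w u : V} (h : IsSplit G Set.univ W₁ W₂ w)
    (h' : IsSplit G W₂ Wa Wb u) (hw : w ∈ Wa) : IsSplit G Set.univ (W₁ ∪ Wa) Wb u where
  union := by rw [Set.union_assoc, h'.union, h.union]
  inter := by
    ext x
    constructor
    · rintro ⟨hx | hx, hb⟩
      · obtain rfl := h.eq hx (h'.right_subset hb)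
        exact h'.eq hw hb
      · exact h'.eq hx hb
    · rintro rfl
      exact ⟨.inr h'.mem_left, h'.mem_right⟩
  adj x hx y hy a := by
    rcases hx with hx | hx
    · rcases h.adj x hx y (h'.right_subset hy) a with rfl | rfl
      · exact h'.adj _ hw y hy a
      · exact .inr (h'.eq hw hy)
    · exact h'.adj x hx y hy a
  left := let ⟨x, hx, hne⟩ := h'.left; ⟨x, .inr hx, hne⟩
  right := h'.right

/-- A graph with a cut vertex and minimum degree at least two has a 2-connected end block. -/
theorem exists_end_block (hG : G.Connected)
    (hdeg : ∀ x, ∃ y z, y ≠ z ∧ G.Adj x y ∧ G.Adj x z)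
    (hk : ¬ IsKConnected 2 (G.induce Set.univ)) :
    ∃ W₁ W₂ w, IsSplit G Set.univ W₁ W₂ w ∧ IsKConnected 2 (G.induce W₂) := by
  classical
  have hcard : ∀ {W : Set V} {x y z : V}, x ∈ W → y ∈ W → z ∈ W → y ≠ z → G.Adj x y → G.Adj x z →
      2 < W.ncard := fun hx hy hz hyz ay az =>
    (Set.two_lt_ncard_iff).2 ⟨_, _, _, hx, hy, hz, ay.ne, az.ne, hyz⟩
  have hex : ∃ n, ∃ W₁ W₂ w, IsSplit G Set.univ W₁ W₂ w ∧ W₂.ncard = n := by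
    obtain ⟨x⟩ := hG.nonempty
    obtain ⟨y, z, hyz, ay, az⟩ := hdeg x
    obtain ⟨W₁, W₂, v, h, -⟩ :=
      exists_isSplit ((IsRetraction.univ G).connected hG).preconnected
        (hcard (Set.mem_univ x) (Set.mem_univ y) (Set.mem_univ z) hyz ay az) hk (Set.mem_univ x)
    exact ⟨_, W₁, W₂, v, h, rfl⟩
  -- A smallest side of any split. Were it not 2-connected, splitting it again would leave a smaller
  -- side avoiding `w` or meeting it only in the new cut vertex.
  obtain ⟨W₁, W₂, w, h, hn⟩ := Nat.find_spec hex
  refine ⟨W₁, W₂, w, h, ?_⟩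
  by_contra hk₂
  have h3 : 2 < W₂.ncard := by
    obtain ⟨x, hx, hxw⟩ := h.right
    obtain ⟨y, z, hyz, ay, az⟩ := hdeg x
    have key : ∀ y, G.Adj x y → y ∈ W₂ := fun y a =>
      ((h.adj_within trivial trivial a).resolve_left fun h' => hxw (h.eq h'.1 hx)).2
    exact hcard hx (key y ay) (key z az) hyz ay az
  have hr₂ := h.symm.retraction (IsRetraction.univ G)
  obtain ⟨Wa, Wb, u, h', hw⟩ := exists_isSplit (hr₂.connected hG).preconnected h3 hk₂ h.mem_right
  have hlt := Set.ncard_lt_ncard h'.symm.ssubset_left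
  rw [hn] at hlt
  exact Nat.find_min hex hlt ⟨_, _, _, h.refine h' hw, rfl⟩

theorem BlockBound.exists_distinguishing (hb : BlockBound G 𝓔) (hG : G.Connected)
    (hE : IsElementSet G 𝓔) (hdeg : ∀ x, ∃ y z, y ≠ z ∧ G.Adj x y ∧ G.Adj x z)
    (hc : ¬ IsCycleGraph (G.induce Set.univ)) :
    ∃ T : Set V, (T.ncard : ℤ) ≤ 2 * cyc G Set.univ - 1 ∧ Distinguishes G 𝓔 Set.univ T := by
  have hr := IsRetraction.univ G
  by_cases hk : IsKConnected 2 (G.induce Set.univ)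
  · obtain ⟨T, -, hT⟩ := hb _ _ hr hk hc
    exact ⟨T, hT⟩
  · obtain ⟨W₁, W₂, w, h, hk₂⟩ := exists_end_block hG hdeg hk
    have hr₁ := h.retraction hr
    obtain ⟨S₁, hS₁, hc₁, d₁, p₁⟩ := hb.exists_protecting_of_degree hG hE _ W₁ _ w ∅ rfl hr₁
      h.mem_left (by
        intro x hx hxw _
        obtain ⟨y, z, hyz, ay, az⟩ := hdeg x
        have key : ∀ y, G.Adj x y → y ∈ W₁ := fun y a =>
          ((h.adj_within trivial trivial a).resolve_right fun h' => hxw (h.eq hx h'.1)).2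
        exact ⟨y, key y ay, z, key z az, hyz, ay, az⟩)
    rw [Set.empty_inter, Set.union_empty] at d₁ p₁
    obtain ⟨S₂, hS₂, hne₂, hc₂, d₂⟩ :=
      hb.exists_rooted hG hE (h.symm.retraction hr) hk₂ h.mem_right
    refine ⟨S₁ ∪ S₂, ?_, Distinguishes.glue_root hG hE hr h d₁ p₁ d₂ hS₁ hS₂
      (p₁.nonempty hE hG hr₁ h.mem_left h.left) hne₂⟩
    have := Set.ncard_union_le S₁ S₂
    rw [h.cyc_add]
    omega

end Reduction

/-! ### From distinguishing sets to metric dimensions -/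

section Dimensions

variable {G : SimpleGraph V}

theorem exists_vdim [Finite V] (hG : G.Connected) :
    ∃ S : Finset V, S.card = vdim G ∧ IsVertexMetricGenerator G S := by
  have := Fintype.ofFinite V
  refine Nat.sInf_mem (s := {n | ∃ S : Finset V, S.card = n ∧ IsVertexMetricGenerator G S})
    ⟨_, Finset.univ, rfl, fun x y hxy => ⟨x, Finset.mem_univ x, ?_⟩⟩
  have := hG.pos_dist_of_ne hxy
  rw [SimpleGraph.dist_self]
  omega

theorem exists_edim [Finite V] (hG : G.Connected) :
    ∃ S : Finset V, S.card = edim G ∧ IsEdgeMetricGenerator G S := by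
  have := Fintype.ofFinite V
  refine Nat.sInf_mem (s := {n | ∃ S : Finset V, S.card = n ∧ IsEdgeMetricGenerator G S})
    ⟨_, Finset.univ, rfl, fun e he f hf hef => ?_⟩
  -- An end of `e`, taken as landmark, is at distance 0 from `e`, so it is also an end of `f`.
  by_contra! hcon
  apply hef
  induction e using Sym2.ind with
  | h a b =>
    rw [SimpleGraph.mem_edgeSet] at he
    have key : ∀ x ∈ s(a, b), x ∈ f := by
      intro x hx
      have h1 := hcon x (Finset.mem_univ x)
      have h2 := edgeDist_le (G := G) x hx
      rw [SimpleGraph.dist_self] at h2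
      obtain ⟨y, hy, hd⟩ := exists_edgeDist_eq (G := G) x f
      obtain rfl : x = y := (hG.dist_eq_zero_iff).1 (by omega)
      exact hy
    exact ((Sym2.mem_and_mem_iff he.ne).1 ⟨key a (by simp), key b (by simp)⟩).symm

theorem edgeDist_map {W : Set V} {r : V → V} (hG : G.Connected) (hr : IsRetraction G W r) (s : W)
    (e : Sym2 W) : edgeDist G s (e.map Subtype.val) = edgeDist (G.induce W) s e := by
  induction e using Sym2.ind with
  | h a b => simp only [Sym2.map_mk, edgeDist_mk, hr.dist_induce hG]

theorem IsVertexMetricGenerator.distinguishes {W : Set V} {r : V → V} (hG : G.Connected)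
    (hr : IsRetraction G W r) {S : Finset W} (hS : IsVertexMetricGenerator (G.induce W) S) :
    Distinguishes G {e | e.IsDiag} W (Subtype.val '' (S : Set W)) := by
  intro e he f hf heW hfW hef
  induction e using Sym2.ind with
  | h a a' =>
  induction f using Sym2.ind with
  | h b b' =>
    obtain rfl : a = a' := by simpa using he
    obtain rfl : b = b' := by simpa using hf
    rw [within_mk] at heW hfW
    obtain ⟨s, hs, hne⟩ := hS ⟨a, heW.1⟩ ⟨b, hfW.1⟩ fun h => hef (by rw [Subtype.mk.inj h])
    refine ⟨s, ⟨s, hs, rfl⟩, ?_⟩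
    rw [hr.dist_induce hG, hr.dist_induce hG] at hne
    simpa using hne

theorem IsEdgeMetricGenerator.distinguishes {W : Set V} {r : V → V} (hG : G.Connected)
    (hr : IsRetraction G W r) {S : Finset W} (hS : IsEdgeMetricGenerator (G.induce W) S) :
    Distinguishes G G.edgeSet W (Subtype.val '' (S : Set W)) := by
  have lift : ∀ e ∈ G.edgeSet, Within W e →
      ∃ e' ∈ (G.induce W).edgeSet, e'.map Subtype.val = e := by
    intro e he heW
    induction e using Sym2.ind with
    | h a b =>
      rw [within_mk] at heW
      exact ⟨s(⟨a, heW.1⟩, ⟨b, heW.2⟩), he, rfl⟩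
  intro e he f hf heW hfW hef
  obtain ⟨e, he', rfl⟩ := lift e he heW
  obtain ⟨f, hf', rfl⟩ := lift f hf hfW
  obtain ⟨s, hs, hne⟩ := hS e he' f hf' fun h => hef (by rw [h])
  refine ⟨s, ⟨s, hs, rfl⟩, ?_⟩
  rwa [edgeDist_map hG hr, edgeDist_map hG hr]

theorem vdim_le_ncard [Finite V] {T : Set V}
    (d : Distinguishes G {e | e.IsDiag} Set.univ T) : vdim G ≤ T.ncard := by
  refine Nat.sInf_le ⟨(Set.toFinite T).toFinset, (Set.ncard_eq_toFinset_card T).symm, ?_⟩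
  intro x y hxy
  obtain ⟨s, hs, hne⟩ := d s(x, x) (by simp) s(y, y) (by simp) (by simp) (by simp)
    (by simpa using hxy)
  exact ⟨s, by simpa using hs, by simpa using hne⟩

theorem edim_le_ncard [Finite V] {T : Set V}
    (d : Distinguishes G G.edgeSet Set.univ T) : edim G ≤ T.ncard := by
  refine Nat.sInf_le ⟨(Set.toFinite T).toFinset, (Set.ncard_eq_toFinset_card T).symm, ?_⟩
  intro e he f hf hef
  obtain ⟨s, hs, hne⟩ := d e he f hf (fun _ _ => trivial) (fun _ _ => trivial) hef
  exact ⟨s, by simpa using hs, hne⟩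

theorem cyc_univ (G : SimpleGraph V) : cyc G Set.univ = cyclomatic G := by
  have : {e | e ∈ G.edgeSet ∧ Within Set.univ e} = G.edgeSet := by
    ext e
    exact ⟨fun h => h.1, fun h => ⟨h, fun _ _ => trivial⟩⟩
  rw [cyc, cyclomatic, this, Set.ncard_univ]

theorem exists_two_neighbors [Fintype V] [DecidableRel G.Adj] (h : 2 ≤ G.minDegree) (x : V) :
    ∃ y z, y ≠ z ∧ G.Adj x y ∧ G.Adj x z := by
  have h1 := h.trans (G.minDegree_le_degree x)
  rw [← SimpleGraph.card_neighborFinset_eq_degree] at h1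
  obtain ⟨y, hy, z, hz, hyz⟩ := Finset.one_lt_card.1 h1
  rw [SimpleGraph.mem_neighborFinset] at hy hz
  exact ⟨y, z, hyz, hy, hz⟩

theorem not_isCycleGraph_induce_univ (h : ¬ IsCycleGraph G) :
    ¬ IsCycleGraph (G.induce Set.univ) := fun ⟨n, hn, ⟨f⟩⟩ =>
  h ⟨n, hn, ⟨(SimpleGraph.induceUnivIso G).symm.trans f⟩⟩

theorem vdim_le_of_blocks [Fintype V] [DecidableRel G.Adj] (hG : G.Connected)
    (hdeg : 2 ≤ G.minDegree) (hc : ¬ IsCycleGraph G)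
    (hb : ∀ H : G.Subgraph, IsNontrivialBlock H → ¬ IsCycleGraph H.coe →
      (vdim H.coe : ℤ) ≤ 2 * cyclomatic H.coe - 1) :
    (vdim G : ℤ) ≤ 2 * cyclomatic G - 1 := by
  have bound : BlockBound G {e | e.IsDiag} := by
    intro W r hr hk hW
    have h : ¬ IsCycleGraph (V := W) ((⊤ : G.Subgraph).induce W).coe →
        (vdim (V := W) ((⊤ : G.Subgraph).induce W).coe : ℤ) ≤
          2 * cyclomatic (V := W) ((⊤ : G.Subgraph).induce W).coe - 1 :=
      hb _ (hr.isNontrivialBlock hk)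
    rw [← SimpleGraph.induce_eq_coe_induce_top, cyclomatic_induce] at h
    obtain ⟨S, hS, hgen⟩ := exists_vdim (hr.connected hG)
    refine ⟨Subtype.val '' (S : Set W), by simp, ?_, hgen.distinguishes hG hr⟩
    rw [Set.ncard_image_of_injective _ Subtype.val_injective, Set.ncard_coe_finset, hS]
    exact h hW
  obtain ⟨T, hT, d⟩ := bound.exists_distinguishing hG (.inl rfl) (exists_two_neighbors hdeg)
    (not_isCycleGraph_induce_univ hc)
  have := vdim_le_ncard d
  rw [cyc_univ] at hT
  omega

theorem edim_le_of_blocks [Fintype V] [DecidableRel G.Adj] (hG : G.Connected)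
    (hdeg : 2 ≤ G.minDegree) (hc : ¬ IsCycleGraph G)
    (hb : ∀ H : G.Subgraph, IsNontrivialBlock H → ¬ IsCycleGraph H.coe →
      (edim H.coe : ℤ) ≤ 2 * cyclomatic H.coe - 1) :
    (edim G : ℤ) ≤ 2 * cyclomatic G - 1 := by
  have bound : BlockBound G G.edgeSet := by
    intro W r hr hk hW
    have h : ¬ IsCycleGraph (V := W) ((⊤ : G.Subgraph).induce W).coe →
        (edim (V := W) ((⊤ : G.Subgraph).induce W).coe : ℤ) ≤
          2 * cyclomatic (V := W) ((⊤ : G.Subgraph).induce W).coe - 1 :=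
      hb _ (hr.isNontrivialBlock hk)
    rw [← SimpleGraph.induce_eq_coe_induce_top, cyclomatic_induce] at h
    obtain ⟨S, hS, hgen⟩ := exists_edim (hr.connected hG)
    refine ⟨Subtype.val '' (S : Set W), by simp, ?_, hgen.distinguishes hG hr⟩
    rw [Set.ncard_image_of_injective _ Subtype.val_injective, Set.ncard_coe_finset, hS]
    exact h hW
  obtain ⟨T, hT, d⟩ := bound.exists_distinguishing hG (.inr rfl) (exists_two_neighbors hdeg)
    (not_isCycleGraph_induce_univ hc)
  have := edim_le_ncard d
  rw [cyc_univ] at hT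
  omega

end Dimensions

end MetricDimension
-- The theorem
theorem mainTheorem3 :
    -- the reduction to the non-trivial blocks of a given graph
    (∀ (V : Type u) [Fintype V] (G : SimpleGraph V) [DecidableRel G.Adj],
      G.Connected → 2 ≤ G.minDegree → ¬ MetricDimension.IsCycleGraph G →
        ((∀ H : G.Subgraph, MetricDimension.IsNontrivialBlock H →
            ¬ MetricDimension.IsCycleGraph H.coe →
            (MetricDimension.vdim H.coe : ℤ) ≤ 2 * MetricDimension.cyclomatic H.coe - 1) →
          (MetricDimension.vdim G : ℤ) ≤ 2 * MetricDimension.cyclomatic G - 1) ∧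
        ((∀ H : G.Subgraph, MetricDimension.IsNontrivialBlock H →
            ¬ MetricDimension.IsCycleGraph H.coe →
            (MetricDimension.edim H.coe : ℤ) ≤ 2 * MetricDimension.cyclomatic H.coe - 1) →
          (MetricDimension.edim G : ℤ) ≤ 2 * MetricDimension.cyclomatic G - 1)) ∧
    -- the conjectured bound on the vertex metric dimension reduces to 2-connected graphs
    ((∀ (V : Type u) [Fintype V] (G : SimpleGraph V) [DecidableRel G.Adj],
        G.Connected → 2 ≤ G.minDegree → ¬ MetricDimension.IsCycleGraph G →
        MetricDimension.IsKConnected 2 G →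
        (MetricDimension.vdim G : ℤ) ≤ 2 * MetricDimension.cyclomatic G - 1) →
      ∀ (V : Type u) [Fintype V] (G : SimpleGraph V) [DecidableRel G.Adj],
        G.Connected → 2 ≤ G.minDegree → ¬ MetricDimension.IsCycleGraph G →
        (MetricDimension.vdim G : ℤ) ≤ 2 * MetricDimension.cyclomatic G - 1) ∧
    -- the conjectured bound on the edge metric dimension reduces to 2-connected graphs
    ((∀ (V : Type u) [Fintype V] (G : SimpleGraph V) [DecidableRel G.Adj],
        G.Connected → 2 ≤ G.minDegree → ¬ MetricDimension.IsCycleGraph G →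
        MetricDimension.IsKConnected 2 G →
        (MetricDimension.edim G : ℤ) ≤ 2 * MetricDimension.cyclomatic G - 1) →
      ∀ (V : Type u) [Fintype V] (G : SimpleGraph V) [DecidableRel G.Adj],
        G.Connected → 2 ≤ G.minDegree → ¬ MetricDimension.IsCycleGraph G →
        (MetricDimension.edim G : ℤ) ≤ 2 * MetricDimension.cyclomatic G - 1) := by
  refine ⟨fun V _ G _ hG hdeg hc => ⟨MetricDimension.vdim_le_of_blocks hG hdeg hc,
    MetricDimension.edim_le_of_blocks hG hdeg hc⟩, fun h V _ G _ hG hdeg hc => ?_,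
    fun h V _ G _ hG hdeg hc => ?_⟩
  · classical
    refine MetricDimension.vdim_le_of_blocks hG hdeg hc fun H hH hHc => ?_
    have hk : MetricDimension.IsKConnected 2 H.coe := hH.1.1
    have := Fintype.ofFinite H.verts
    -- A block is 2-connected, which already forces connectedness and minimum degree two, so the
    -- assumed bound applies to it.
    exact h _ H.coe hk.connected hk.two_le_minDegree hHc hk
  · classical
    refine MetricDimension.edim_le_of_blocks hG hdeg hc fun H hH hHc => ?_
    have hk : MetricDimension.IsKConnected 2 H.coe := hH.1.1
    have := Fintype.ofFinite H.verts
    exact h _ H.coe hk.connected hk.two_le_minDegree hHc hk
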